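/- Positions in strings and arrays start from $1$. For a string $v$, the suffix-palindromes of $v$ (the palindromic suffixes, including the empty one) are partitioned by the character of $v$ immediately to their left, a suffix equal to $v$ itself, which has no such character, forming a class of its own; the classes are the suffix-pal-groups of $v$. The representative of a group is its shortest member, and the groups receive the identifiers $1, 2, 3, \dots$ in increasing order of the lengths of their representatives. For a string $w$ over an arbitrary alphabet define three arrays of length $|w|$, for $1 \le i \le |w|$: (1) $\mathsf{ssp}_w[i]$ is the length of the shortest suffix-palindrome of $w[1..i]$ of length at least $2$ if there is one, and $\infty$ otherwise; (2) $\mathsf{G}_w[i]$ is the number of suffix-pal-groups of $w[1..i]$; (3) $\mathsf{sspg}_w[i]$ is the identifier of the suffix-pal-group of $w[1..i-1]$ whose members have the character $w[i]$ immediately to their left (so that they are extended outwards to palindromes by appending $w[i]$) if there is one, and $\infty$ otherwise. Then each of the arrays $\mathsf{ssp}_w$, $\mathsf{G}_w$ and $\mathsf{sspg}_w$ can be computed from $w$ in $O(|w|)$ time. Precisely: for each of the three there are a program for a unit-cost word RAM and a constant $C$ such that, for every string $w$ over any alphabet, the program, run on a machine whose words hold the integers from $0$ to $C(|w|+1)-1$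 and which accesses $w$ only through its length and equality tests between characters at given positions, halts within $C(|w|+1)$ steps and outputs the array (an entry in $\mathbb{N}\cup\{\infty\}$ is output as $0$ if it is $\infty$ and as $k+1$ if it is the integer $k$). -/

import Mathlib

universe u

namespace PalEnc

/-! ## Suffix-palindromes and the three arrays

Positions are `0`-based: the entry with index `i` belongs to position `i + 1` of the string. -/

section Arrays

variable {α : Type u}

/-- The suffix of `v` of length `l` is a palindrome (`l = 0` is the empty suffix). -/
def SuffixPal (v : List α) (l : ℕ) : Prop :=
  l ≤ v.length ∧ (v.drop (v.length - l)).Palindrome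

/-- The character immediately to the left of the suffix of `v` of length `l`; it is `none` when
that suffix is the whole of `v`. -/
def leftChar (v : List α) (l : ℕ) : Option α :=
  (v.take (v.length - l)).getLast?

/-- The set of (lengths of) suffix-palindromes of `v` that have `c` immediately to their left. -/
def palGroup (v : List α) (c : Option α) : Set ℕ :=
  {l | SuffixPal v l ∧ leftChar v l = c}

/-- The suffix-pal-groups of `v`: the classes of the partition of the suffix-palindromes of `v`
by the character immediately to their left. A suffix-palindrome is identified with its length. -/
def palGroups (v : List α) : Set (Set ℕ) :=
  {g | ∃ c : Option α, g = palGroup v c ∧ g.Nonempty}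

/-- The length of the representative (the shortest member) of a suffix-pal-group. -/
noncomputable def repLength (g : Set ℕ) : ℕ := sInf g

/-- The identifier of a suffix-pal-group `g` of `v`: its rank, counted from `1`, when the groups
are sorted by the lengths of their representatives. -/
noncomputable def groupId (v : List α) (g : Set ℕ) : ℕ :=
  {h | h ∈ palGroups v ∧ repLength h ≤ repLength g}.ncard

/-- The `ssp`-encoding: the length of the shortest suffix-palindrome of length at least `2` of the
prefix that ends at the given position, and `⊤` if there is none. -/
noncomputable def ssp (w : List α) (i : Fin w.length) : ℕ∞ :=
  sInf {x : ℕ∞ | ∃ l : ℕ, 2 ≤ l ∧ SuffixPal (w.take (i + 1)) l ∧ x = l}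

/-- The number of suffix-pal-groups of the prefix that ends at the given position. -/
noncomputable def numGroups (w : List α) (i : Fin w.length) : ℕ :=
  (palGroups (w.take (i + 1))).ncard

open Classical in
/-- The `sspg`-encoding: the identifier of the suffix-pal-group of the prefix before the given
position whose members are extended outwards by the character at that position (that is, whose
members have this character immediately to their left), and `⊤` if there is none. -/
noncomputable def sspg (w : List α) (i : Fin w.length) : ℕ∞ :=
  if (palGroup (w.take i) (some (w.get i))).Nonempty then
    (groupId (w.take i) (palGroup (w.take i) (some (w.get i))) : ℕ∞)
  else ⊤

end Arrays

/-! ## The machine model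

A unit-cost word RAM in structured form. Registers and memory cells hold natural numbers below a
capacity `B`; an instruction whose result does not fit has no execution. The input is a read-only
string over an arbitrary alphabet, whose characters can only be tested for equality.
Every instruction and every evaluated test costs one step. -/

/-- Tests on registers. `charEq a b` compares the input characters at the (`0`-based) positions
held in the registers `a` and `b`. -/
inductive Test : Type
  | eq (a b : ℕ)
  | lt (a b : ℕ)
  | charEq (a b : ℕ)

/-- Programs; the numbers `r a b` name registers. -/
inductive Prog : Type
  /-- no operation -/
  | skip
  /-- `r := c` -/
  | const (r c : ℕ)
  /-- `r := a` -/
  | copy (r a : ℕ)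
  /-- `r := a + b` -/
  | add (r a b : ℕ)
  /-- `r := a - b`, truncated at `0` -/
  | sub (r a b : ℕ)
  /-- `r := mem[a]` -/
  | load (r a : ℕ)
  /-- `mem[a] := b` -/
  | store (a b : ℕ)
  /-- one program after the other -/
  | seq (p q : Prog)
  /-- conditional -/
  | ite (c : Test) (p q : Prog)
  /-- loop -/
  | loop (c : Test) (p : Prog)

/-- The contents of the registers and of the memory cells. -/
structure State : Type where
  reg : ℕ → ℕ
  mem : ℕ → ℕ

/-- Overwrite one register. -/
def State.setReg (s : State) (r x : ℕ) : State :=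
  { s with reg := Function.update s.reg r x }

/-- Overwrite one memory cell. -/
def State.setMem (s : State) (a x : ℕ) : State :=
  { s with mem := Function.update s.mem a x }

/-- The initial state: register `0` holds the length of the input, all else is `0`. -/
def State.init (n : ℕ) : State where
  reg := Function.update (fun _ => 0) 0 n
  mem := fun _ => 0

/-- A test may be evaluated; characters are compared only at positions inside the input. -/
def Test.Defined {α : Type u} (w : List α) (s : State) : Test → Prop
  | .eq _ _ => True
  | .lt _ _ => True
  | .charEq a b => s.reg a < w.length ∧ s.reg b < w.length

/-- The test succeeds. -/
def Test.Holds {α : Type u} (w : List α) (s : State) : Test → Prop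
  | .eq a b => s.reg a = s.reg b
  | .lt a b => s.reg a < s.reg b
  | .charEq a b => w[s.reg a]? = w[s.reg b]?

/-- `Exec B w p s t s'`: on the input `w` and with word capacity `B`, the program `p` started in
the state `s` halts in the state `s'` after exactly `t` steps. -/
inductive Exec {α : Type u} (B : ℕ) (w : List α) : Prog → State → ℕ → State → Prop
  | skip (s : State) : Exec B w .skip s 1 s
  | const (s : State) (r c : ℕ) (h : c < B) : Exec B w (.const r c) s 1 (s.setReg r c)
  | copy (s : State) (r a : ℕ) : Exec B w (.copy r a) s 1 (s.setReg r (s.reg a))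
  | add (s : State) (r a b : ℕ) (h : s.reg a + s.reg b < B) :
      Exec B w (.add r a b) s 1 (s.setReg r (s.reg a + s.reg b))
  | sub (s : State) (r a b : ℕ) : Exec B w (.sub r a b) s 1 (s.setReg r (s.reg a - s.reg b))
  | load (s : State) (r a : ℕ) : Exec B w (.load r a) s 1 (s.setReg r (s.mem (s.reg a)))
  | store (s : State) (a b : ℕ) : Exec B w (.store a b) s 1 (s.setMem (s.reg a) (s.reg b))
  | seq {p q : Prog} {s s' s'' : State} {t t' : ℕ} (hp : Exec B w p s t s')
      (hq : Exec B w q s' t' s'') : Exec B w (.seq p q) s (t + t') s''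
  | iteTrue {c : Test} {p q : Prog} {s s' : State} {t : ℕ} (hd : c.Defined w s)
      (hc : c.Holds w s) (hp : Exec B w p s t s') : Exec B w (.ite c p q) s (1 + t) s'
  | iteFalse {c : Test} {p q : Prog} {s s' : State} {t : ℕ} (hd : c.Defined w s)
      (hc : ¬ c.Holds w s) (hq : Exec B w q s t s') : Exec B w (.ite c p q) s (1 + t) s'
  | loopTrue {c : Test} {p : Prog} {s s' s'' : State} {t t' : ℕ} (hd : c.Defined w s)
      (hc : c.Holds w s) (hp : Exec B w p s t s') (hl : Exec B w (.loop c p) s' t' s'') :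
      Exec B w (.loop c p) s (1 + t + t') s''
  | loopFalse {c : Test} {p : Prog} {s : State} (hd : c.Defined w s) (hc : ¬ c.Holds w s) :
      Exec B w (.loop c p) s 1 s

/-- An array `f w` of `|w|` natural numbers is computable from the string `w` in `O(|w|)` time:
one program and one constant `C` serve all strings over all alphabets; with words that hold the
numbers below `C * (|w| + 1)` (that is, `log |w| + O(1)` bits) the program halts within
`C * (|w| + 1)` steps, with the array in the first `|w|` memory cells. -/
def LinearTime (f : (α : Type u) → (w : List α) → Fin w.length → ℕ) : Prop :=
  ∃ (p : Prog) (C : ℕ), ∀ (α : Type u) (w : List α), ∃ (t : ℕ) (s : State),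
    Exec (C * (w.length + 1)) w p (State.init w.length) t s ∧
    t ≤ C * (w.length + 1) ∧ ∀ i : Fin w.length, s.mem i = f α w i

/-- How an array entry that may be infinite is stored in a memory cell (injectively). -/
def code (x : ℕ∞) : ℕ := if x = ⊤ then 0 else x.toNat + 1

end PalEnc

/-! Give a palindrome occupying `[s, e)` the doubled centre `m = s + e`, and let `R m` be the right
end of the maximal palindrome with doubled centre `m`. Palindromes with a fixed centre are nested,
so the prefix of length `e` has a suffix-palindrome of length `l` exactly when `e ≤ R (2 * e - l)`.
Manacher's algorithm computes all the `R m` in linear time.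

The shortest suffix-palindrome of length at least `2` then corresponds to the largest `m` with `m +
2 ≤ 2 * e` and `e ≤ R m`. A stack finds it for every `e`: a centre once found too short stays too
short as `e` grows, so each centre is pushed and popped at most once. This gives `ssp`. The same
sweep over the reversed string gives the shortest palindrome of length at least `2` starting at each
position.

Counting groups means counting representatives (`bijOn_repLength`). The suffix-palindromes of the
prefix of length `e` that extend by the next character all have that character on their left. They
form at most one group, whose shortest member is two shorter than the shortest palindrome of length
at least `2` ending one position later. Every other suffix-palindrome is maximal in the whole
string, so it has `R m = e`. Whether such a palindrome `[s, e)` is a representative can be tested in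
constant time. A shorter suffix-palindrome with the same left character, reflected in `[s, e)`,
becomes a prefix of `[s, e)` enclosed by two copies of the character at `s - 1`. So `[s, e)` is a
representative exactly when no palindrome of length at least `2` starts at `s - 1` and ends by `e`
(`fresh_iff`, `mem_reps_iff`).

Each of the `2 * n + 1` centres is maximal for just one right end, so one pass over the centres
fills all the counters for `G`. The identifier in `sspg` is the rank of the representative of the
extended group. It is obtained from the same pass by counting only the representatives shorter than
that one.

The programs are verified with a weakest-precondition calculus carrying a step budget
(`exec_of_vc`). The amortized running times appear as potentials in the loop invariants. -/

namespace PalEnc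

/-! ## Palindromic intervals and maximal palindromes -/

section Intervals

variable {β : Type*} {f : ℕ → β} {n : ℕ}

/-- The interval `[s, e)` of `f` reads the same in both directions. -/
def IsPal (f : ℕ → β) (s e : ℕ) : Prop :=
  ∀ k, s ≤ k → k < e → f k = f (s + e - 1 - k)

theorem IsPal.of_le {s e : ℕ} (h : e ≤ s + 1) : IsPal f s e := by
  intro k hk hke
  congr 1
  omega

theorem isPal_extend {s e : ℕ} (h : s ≤ e) :
    IsPal f s (e + 2) ↔ IsPal f (s + 1) (e + 1) ∧ f s = f (e + 1) := by
  constructor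
  · intro H
    refine ⟨fun k hk hke => ?_, ?_⟩
    · rw [H k (by omega) (by omega)]
      congr 1
      omega
    · rw [H s (by omega) (by omega)]
      congr 1
      omega
  · rintro ⟨H, h0⟩ k hk hke
    rcases Nat.eq_or_lt_of_le hk with rfl | hk'
    · rw [h0]
      congr 1
      omega
    · rcases Nat.eq_or_lt_of_le (show k ≤ e + 1 by omega) with rfl | hk''
      · rw [← h0]
        congr 1
        omega
      · rw [H k (by omega) (by omega)]
        congr 1
        omega

theorem IsPal.reflect {s e a b : ℕ} (H : IsPal f s e) (hsa : s ≤ a) (hbe : b ≤ e)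
    (hab : a ≤ b) (h : IsPal f a b) : IsPal f (s + e - b) (s + e - a) := by
  intro k hk hke
  rw [H k (by omega) (by omega), h _ (by omega) (by omega),
    H (s + e - b + (s + e - a) - 1 - k) (by omega) (by omega)]
  congr 1
  omega

theorem IsPal.reflect_iff {s e a b : ℕ} (H : IsPal f s e) (hsa : s ≤ a) (hbe : b ≤ e)
    (hab : a ≤ b) : IsPal f (s + e - b) (s + e - a) ↔ IsPal f a b := by
  refine ⟨fun h => ?_, H.reflect hsa hbe hab⟩
  have := H.reflect (by omega) (by omega) (by omega) h
  convert this using 1 <;> omega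

/-- Shrinking a palindrome around its centre. -/
theorem IsPal.shrink {m e e' : ℕ} (h : IsPal f (m - e) e) (he : e ≤ m) (h1 : e' ≤ e)
    (_ : m ≤ 2 * e') : IsPal f (m - e') e' := by
  intro k hk hke
  rw [h k (by omega) (by omega)]
  congr 1
  omega

theorem IsPal.grow {m e : ℕ} (h : IsPal f (m - e) e) (hme : m ≤ 2 * e) (hem : e < m)
    (h0 : f (m - e - 1) = f e) : IsPal f (m - (e + 1)) (e + 1) := by
  rcases Nat.eq_zero_or_pos e with rfl | he
  · omega
  obtain ⟨c, rfl⟩ : ∃ c, e = c + 1 := ⟨e - 1, by omega⟩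
  rw [isPal_extend (by omega)]
  constructor
  · convert h using 1
    omega
  · rw [← h0]
    congr 1

open Classical in
/-- The right end of the maximal palindrome of `f` inside `[0, n)` whose ends have the sum `m`. -/
noncomputable def rad (f : ℕ → β) (n m : ℕ) : ℕ :=
  Nat.findGreatest (fun e => m ≤ 2 * e ∧ e ≤ m ∧ IsPal f (m - e) e) n

theorem rad_spec {m : ℕ} (hm : m ≤ 2 * n) :
    m ≤ 2 * rad f n m ∧ rad f n m ≤ m ∧ IsPal f (m - rad f n m) (rad f n m) := by
  classical
  unfold rad
  refine Nat.findGreatest_spec (P := fun e => m ≤ 2 * e ∧ e ≤ m ∧ IsPal f (m - e) e)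
    (m := (m + 1) / 2) (by omega) ⟨by omega, by omega, IsPal.of_le (by omega)⟩

theorem rad_le : ∀ {m : ℕ}, rad f n m ≤ n := by
  classical
  exact fun {m} => Nat.findGreatest_le n

/-- A palindrome may be shrunk about its centre, so the admissible right ends form an interval with
`rad f n m` as its top. All later statements about palindromes become inequalities through this
equivalence. -/
theorem le_rad_iff {m e : ℕ} (hm : m ≤ 2 * n) (h1 : m ≤ 2 * e) (h2 : e ≤ m) (h3 : e ≤ n) :
    e ≤ rad f n m ↔ IsPal f (m - e) e := by
  classical
  constructor
  · intro h
    obtain ⟨_, h5, h6⟩ := rad_spec (f := f) hm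
    exact h6.shrink h5 h h1
  · intro h
    exact Nat.le_findGreatest h3 ⟨h1, h2, h⟩

theorem rad_eq {m e : ℕ} (h1 : m ≤ 2 * e) (h2 : e ≤ m) (h3 : e ≤ n)
    (h : IsPal f (m - e) e) (hmax : e < n → e < m → f (m - e - 1) ≠ f e) : rad f n m = e := by
  have hm : m ≤ 2 * n := by omega
  refine le_antisymm ?_ ((le_rad_iff hm h1 h2 h3).2 h)
  by_contra! hlt
  obtain ⟨_, h5, _⟩ := rad_spec (f := f) hm
  have h7 := rad_le (f := f) (n := n) (m := m)
  have h8 := (le_rad_iff (f := f) (e := e + 1) hm (by omega) (by omega) (by omega)).1 hlt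
  rcases Nat.eq_or_lt_of_le h1 with h9 | h9
  · obtain ⟨c, rfl⟩ : ∃ c, e = c + 1 := ⟨e - 1, by omega⟩
    rw [show m - (c + 1 + 1) = c by omega, isPal_extend (by omega)] at h8
    apply hmax (by omega) (by omega)
    rw [← h8.2]
    congr 1
    omega
  · obtain ⟨c, rfl⟩ : ∃ c, e = c + 1 := ⟨e - 1, by omega⟩
    rw [isPal_extend (by omega)] at h8
    apply hmax (by omega) (by omega)
    rw [← h8.2]
    congr 1

/-- Reflection in the maximal palindrome of centre `m₀` matches the palindromes of centre `m` inside
it with those of centre `2 * m₀ - m`. As the mirrored right end is strictly inside, the failure to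
extend is visible inside as well and is mirrored too. -/
theorem rad_mirror_lt {m m₀ : ℕ} (h0 : m₀ ≤ 2 * n) (h1 : m₀ < m) (h2 : m ≤ 2 * rad f n m₀)
    (h : rad f n (2 * m₀ - m) + m - m₀ < rad f n m₀) :
    rad f n m = rad f n (2 * m₀ - m) + m - m₀ := by
  obtain ⟨a1, a2, a3⟩ := rad_spec (f := f) h0
  have a4 := rad_le (f := f) (n := n) (m := m₀)
  have hm : 2 * m₀ - m ≤ 2 * n := by omega
  obtain ⟨b1, b2, b3⟩ := rad_spec (f := f) hm
  set e := rad f n m₀ with he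
  set r := rad f n (2 * m₀ - m) with hr
  have key : ∀ k, m ≤ 2 * k → k ≤ e → (IsPal f (m - k) k ↔ k ≤ r + m - m₀) := by
    intro k hk1 hk2
    rw [← a3.reflect_iff (a := m - k) (b := k) (by omega) hk2 (by omega)]
    have := le_rad_iff (f := f) (n := n) (m := 2 * m₀ - m) (e := m₀ + k - m) hm
      (by omega) (by omega) (by omega)
    rw [show m₀ - e + e - k = 2 * m₀ - m - (m₀ + k - m) by omega,
      show m₀ - e + e - (m - k) = m₀ + k - m by omega, ← this, ← hr]
    omega
  have c1 := (key (r + m - m₀) (by omega) (by omega)).2 le_rfl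
  have c2 := key (r + m - m₀ + 1) (by omega) (by omega)
  refine le_antisymm ?_ ((le_rad_iff (by omega) (by omega) (by omega) (by omega)).2 c1)
  by_contra! hlt
  have := (le_rad_iff (f := f) (n := n) (m := m) (e := r + m - m₀ + 1) (by omega)
    (by omega) (by omega) (by omega)).1 hlt
  have := c2.1 this
  omega

/-- The complementary case: the mirror image reaches the border, so the palindrome of centre `m`
reaches at least the known right end, and character comparisons need to start only there. -/
theorem isPal_of_mirror {m m₀ : ℕ} (h0 : m₀ ≤ 2 * n) (h1 : m₀ < m) (h2 : m ≤ 2 * rad f n m₀)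
    (h : rad f n m₀ ≤ rad f n (2 * m₀ - m) + m - m₀) :
    IsPal f (m - rad f n m₀) (rad f n m₀) := by
  obtain ⟨a1, a2, a3⟩ := rad_spec (f := f) h0
  have a4 := rad_le (f := f) (n := n) (m := m₀)
  have hm : 2 * m₀ - m ≤ 2 * n := by omega
  set e := rad f n m₀ with he
  rw [← a3.reflect_iff (a := m - e) (b := e) (by omega) le_rfl (by omega)]
  have := le_rad_iff (f := f) (n := n) (m := 2 * m₀ - m) (e := m₀ + e - m) hm
      (by omega) (by omega) (by omega)
  rw [show m₀ - e + e - e = 2 * m₀ - m - (m₀ + e - m) by omega,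
    show m₀ - e + e - (m - e) = m₀ + e - m by omega, ← this]
  omega

end Intervals

open Classical in
/-- For the largest `m` with `m + 2 ≤ 2 * e` and `e ≤ A m`, the number `2 * e - m`, increased
by one; `0` if there is no such `m`. -/
noncomputable def topCode (A : ℕ → ℕ) (e : ℕ) : ℕ :=
  if ∃ m, m + 2 ≤ 2 * e ∧ e ≤ A m then
    2 * e + 1 - Nat.findGreatest (fun m => m + 2 ≤ 2 * e ∧ e ≤ A m) (2 * e)
  else 0

theorem topCode_eq_zero {A : ℕ → ℕ} {e : ℕ} (h : ∀ m, m + 2 ≤ 2 * e → A m < e) :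
    topCode A e = 0 := by
  unfold topCode
  rw [if_neg]
  rintro ⟨m, h1, h2⟩
  have := h m h1
  omega

theorem topCode_eq {A : ℕ → ℕ} {e m : ℕ} (h1 : m + 2 ≤ 2 * e) (h2 : e ≤ A m)
    (h : ∀ m', m < m' → m' + 2 ≤ 2 * e → A m' < e) : topCode A e = 2 * e + 1 - m := by
  classical
  unfold topCode
  rw [if_pos ⟨m, h1, h2⟩]
  congr 1
  rw [Nat.findGreatest_eq_iff]
  refine ⟨by omega, fun _ => ⟨h1, h2⟩, fun k hk _ hk2 => ?_⟩
  have := h k hk hk2.1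
  omega

theorem topCode_cases (A : ℕ → ℕ) (e : ℕ) :
    (topCode A e = 0 ∧ ∀ m, m + 2 ≤ 2 * e → A m < e) ∨
    ∃ m, m + 2 ≤ 2 * e ∧ e ≤ A m ∧ (∀ m', m < m' → m' + 2 ≤ 2 * e → A m' < e) ∧
      topCode A e = 2 * e + 1 - m := by
  classical
  by_cases h : ∃ m, m + 2 ≤ 2 * e ∧ e ≤ A m
  · right
    obtain ⟨m, hm⟩ := h
    have hs := Nat.findGreatest_spec (P := fun m => m + 2 ≤ 2 * e ∧ e ≤ A m) (n := 2 * e)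
      (by omega) hm
    refine ⟨_, hs.1, hs.2, fun m' h1 h2 => ?_, ?_⟩
    · by_contra! h3
      exact absurd ⟨h2, h3⟩ (Nat.findGreatest_is_greatest h1 (by omega))
    · unfold topCode
      rw [if_pos ⟨m, hm⟩]
  · left
    push Not at h
    exact ⟨topCode_eq_zero h, h⟩

/-! ## Verification conditions for programs with a time budget -/

/-- Consecutive execution. -/
def block : List Prog → Prog
  | [] => .skip
  | p :: ps => .seq p (block ps)

/-- A sufficient condition for `p`, started in `s` with a budget of `b` steps, to halt within the
budget in a state that satisfies `Q` together with the remaining budget. -/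
def vc {α : Type u} (B : ℕ) (w : List α) :
    Prog → (State → ℕ → Prop) → State → ℕ → Prop
  | .skip, Q, s, b => 1 ≤ b ∧ Q s (b - 1)
  | .const r c, Q, s, b => c < B ∧ 1 ≤ b ∧ Q (s.setReg r c) (b - 1)
  | .copy r a, Q, s, b => 1 ≤ b ∧ Q (s.setReg r (s.reg a)) (b - 1)
  | .add r a c, Q, s, b =>
      s.reg a + s.reg c < B ∧ 1 ≤ b ∧ Q (s.setReg r (s.reg a + s.reg c)) (b - 1)
  | .sub r a c, Q, s, b => 1 ≤ b ∧ Q (s.setReg r (s.reg a - s.reg c)) (b - 1)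
  | .load r a, Q, s, b => 1 ≤ b ∧ Q (s.setReg r (s.mem (s.reg a))) (b - 1)
  | .store a c, Q, s, b => 1 ≤ b ∧ Q (s.setMem (s.reg a) (s.reg c)) (b - 1)
  | .seq p q, Q, s, b => vc B w p (fun s' b' => vc B w q Q s' b') s b
  | .ite c p q, Q, s, b => c.Defined w s ∧ 1 ≤ b ∧ (c.Holds w s → vc B w p Q s (b - 1)) ∧
      (¬ c.Holds w s → vc B w q Q s (b - 1))
  | .loop c p, Q, s, b => ∃ I : State → ℕ → Prop, I s b ∧ ∀ s b, I s b →
      c.Defined w s ∧ 1 ≤ b ∧ (c.Holds w s → vc B w p I s (b - 1)) ∧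
      (¬ c.Holds w s → Q s (b - 1))

/-- Every evaluated test consumes budget, so the budget itself is the termination measure: loops
need an invariant but no separate variant. -/
theorem exec_of_vc {α : Type u} {B : ℕ} {w : List α} : ∀ (p : Prog) (Q : State → ℕ → Prop)
    (s : State) (b : ℕ), vc B w p Q s b → ∃ t s', Exec B w p s t s' ∧ t ≤ b ∧ Q s' (b - t)
  | .skip, _, s, _, ⟨h1, h2⟩ => ⟨1, s, .skip s, h1, h2⟩
  | .const r c, _, s, _, ⟨h0, h1, h2⟩ => ⟨1, _, .const s r c h0, h1, h2⟩
  | .copy r a, _, s, _, ⟨h1, h2⟩ => ⟨1, _, .copy s r a, h1, h2⟩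
  | .add r a c, _, s, _, ⟨h0, h1, h2⟩ => ⟨1, _, .add s r a c h0, h1, h2⟩
  | .sub r a c, _, s, _, ⟨h1, h2⟩ => ⟨1, _, .sub s r a c, h1, h2⟩
  | .load r a, _, s, _, ⟨h1, h2⟩ => ⟨1, _, .load s r a, h1, h2⟩
  | .store a c, _, s, _, ⟨h1, h2⟩ => ⟨1, _, .store s a c, h1, h2⟩
  | .seq p q, Q, s, b, h => by
      obtain ⟨t, s', h1, h2, h3⟩ := exec_of_vc p _ s b h
      obtain ⟨t', s'', h4, h5, h6⟩ := exec_of_vc q _ s' _ h3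
      exact ⟨t + t', s'', .seq h1 h4, by omega, by rwa [← Nat.sub_sub]⟩
  | .ite c p q, Q, s, b, ⟨hd, hb, hT, hF⟩ => by
      by_cases hc : c.Holds w s
      · obtain ⟨t, s', h1, h2, h3⟩ := exec_of_vc p _ s _ (hT hc)
        exact ⟨1 + t, s', .iteTrue hd hc h1, by omega, by rwa [← Nat.sub_sub]⟩
      · obtain ⟨t, s', h1, h2, h3⟩ := exec_of_vc q _ s _ (hF hc)
        exact ⟨1 + t, s', .iteFalse hd hc h1, by omega, by rwa [← Nat.sub_sub]⟩
  | .loop c p, Q, s, b, ⟨I, hI, hstep⟩ => by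
      induction b using Nat.strong_induction_on generalizing s with
      | _ b ih =>
        obtain ⟨hd, hb, hT, hF⟩ := hstep s b hI
        by_cases hc : c.Holds w s
        · obtain ⟨t, s', h1, h2, h3⟩ := exec_of_vc p _ s _ (hT hc)
          obtain ⟨t', s'', h4, h5, h6⟩ := ih (b - 1 - t) (by omega) s' h3
          refine ⟨1 + t + t', s'', .loopTrue hd hc h1 h4, by omega, ?_⟩
          rwa [show b - (1 + t + t') = b - 1 - t - t' by omega]
        · exact ⟨1, s, .loopFalse hd hc, hb, hF hc⟩

/-- The registers that hold the constants of the programs. -/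
structure Env (n : ℕ) (s : State) : Prop where
  r0 : s.reg 0 = n
  r1 : s.reg 1 = 1
  r2 : s.reg 2 = n + 2
  r3 : s.reg 3 = 3 * (n + 2)
  r4 : s.reg 4 = 5 * (n + 2)
  r5 : s.reg 5 = 7 * (n + 2)
  r6 : s.reg 6 = 8 * (n + 2)
  r7 : s.reg 7 = 9 * (n + 2)
  r8 : s.reg 8 = 10 * (n + 2)
  r9 : s.reg 9 = 2 * n + 1
  r10 : s.reg 10 = n + 1

theorem Env.setReg {n r x : ℕ} {s : State} (h : Env n s) (hr : 10 < r) :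
    Env n (s.setReg r x) := by
  constructor <;> (unfold State.setReg; dsimp only; rw [Function.update_of_ne (by omega)])
  exacts [h.r0, h.r1, h.r2, h.r3, h.r4, h.r5, h.r6, h.r7, h.r8, h.r9, h.r10]

theorem Env.setMem {n a x : ℕ} {s : State} (h : Env n s) : Env n (s.setMem a x) :=
  ⟨h.r0, h.r1, h.r2, h.r3, h.r4, h.r5, h.r6, h.r7, h.r8, h.r9, h.r10⟩

theorem env_setReg_iff {n r x : ℕ} {s : State} (hr : 10 < r) :
    Env n (s.setReg r x) ↔ Env n s := by
  refine ⟨fun h => ?_, fun h => h.setReg hr⟩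
  have h' := h.setReg (r := r) (x := s.reg r) hr
  simpa [State.setReg] using h'

theorem env_setMem_iff {n a x : ℕ} {s : State} : Env n (s.setMem a x) ↔ Env n s :=
  ⟨fun h => ⟨h.r0, h.r1, h.r2, h.r3, h.r4, h.r5, h.r6, h.r7, h.r8, h.r9, h.r10⟩, Env.setMem⟩

theorem State.setReg_reg (s : State) (r x r' : ℕ) :
    (s.setReg r x).reg r' = if r' = r then x else s.reg r' := by
  simp [State.setReg, Function.update_apply]

theorem State.setReg_mem (s : State) (r x : ℕ) : (s.setReg r x).mem = s.mem := rfl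

theorem State.setMem_reg (s : State) (a x : ℕ) : (s.setMem a x).reg = s.reg := rfl

theorem State.setMem_mem (s : State) (a x a' : ℕ) :
    (s.setMem a x).mem a' = if a' = a then x else s.mem a' := by
  simp [State.setMem, Function.update_apply]

/-- Compute the constants. -/
def setupProg : Prog :=
  block [.const 1 1, .add 10 0 1, .add 9 10 0, .add 2 10 1, .add 11 2 2, .add 3 11 2,
    .add 4 3 11, .add 5 4 11, .add 6 5 2, .add 7 6 2, .add 8 7 2]

theorem vc_setup {α : Type u} {B n b : ℕ} {w : List α} {Q : State → ℕ → Prop}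
    (hB : 12 * (n + 2) ≤ B) (hb : 12 ≤ b)
    (hQ : ∀ s b', Env n s → s.mem = (fun _ => 0) → b ≤ b' + 12 → Q s b') :
    vc B w setupProg Q (State.init n) b := by
  simp [setupProg, block, vc, State.init, State.setReg, Nat.sub_sub]
  refine ⟨by omega, by omega, by omega, by omega, by omega, by omega, by omega, by omega,
    by omega, by omega, by omega, by omega, by omega, by omega, by omega, by omega,
    by omega, by omega, by omega, by omega, by omega, by omega, by omega, ?_⟩
  refine hQ _ _ ?_ rfl (by omega)
  constructor <;> simp <;> omega

/-! ## Maximal palindromes -/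

/-- Extend the palindrome with centre in register `11` and right end in register `13`. -/
def extendProg : Prog :=
  .loop (.eq 15 1) (block [.const 15 0,
    .ite (.lt 13 0)
      (.ite (.lt 13 11)
        (block [.sub 16 11 13, .sub 16 16 1,
          .ite (.charEq 16 13) (block [.add 13 13 1, .const 15 1]) .skip])
        .skip)
      .skip])

theorem vc_extend {α : Type u} {B b m e : ℕ} {w : List α} {s : State} {Q : State → ℕ → Prop}
    (hE : Env w.length s) (hB : 12 * (w.length + 2) ≤ B) (h11 : s.reg 11 = m)
    (h13 : s.reg 13 = e) (h15 : s.reg 15 = 1) (h1 : m ≤ 2 * e) (h2 : e ≤ m)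
    (h3 : e ≤ w.length) (hp : IsPal (fun k => w[k]?) (m - e) e)
    (hb : 20 * (w.length - e) + 20 ≤ b)
    (hQ : ∀ s' b', Env w.length s' → s'.mem = s.mem → s'.reg 11 = m →
      s'.reg 13 = rad (fun k => w[k]?) w.length m → e ≤ rad (fun k => w[k]?) w.length m →
      s'.reg 12 = s.reg 12 →
      b + 20 * e ≤ b' + 20 * rad (fun k => w[k]?) w.length m + 20 → Q s' b') :
    vc B w extendProg Q s b := by
  -- A successful comparison is paid for by the growth of the right end, at `20` steps per unit. The
  -- term with register `15` reserves `18` steps for the last round, which clears the flag without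
  -- extending.
  refine ⟨fun s' b' => Env w.length s' ∧ s'.mem = s.mem ∧ s'.reg 11 = m ∧
    s'.reg 12 = s.reg 12 ∧ s'.reg 15 ≤ 1 ∧ e ≤ s'.reg 13 ∧ s'.reg 13 ≤ m ∧
      s'.reg 13 ≤ w.length ∧ IsPal (fun k => w[k]?) (m - s'.reg 13) (s'.reg 13) ∧
      (s'.reg 15 = 0 → rad (fun k => w[k]?) w.length m = s'.reg 13) ∧
      b + 20 * e + 18 * s'.reg 15 ≤ b' + 20 * s'.reg 13 + 18 ∧
      20 * (w.length - s'.reg 13) + 18 * s'.reg 15 + 2 ≤ b', ?_, ?_⟩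
  · refine ⟨hE, rfl, h11, rfl, ?_⟩
    rw [h13, h15]
    exact ⟨by omega, by omega, h2, h3, hp, by simp, by omega, by omega⟩
  · rintro s' b' ⟨hE', hm', h11', h12', hfl, hee, hem, hen, hp', hr, hb1, hb2⟩
    refine ⟨trivial, by omega, fun hc => ?_, fun hc => ?_⟩
    · simp only [Test.Holds, hE'.r1] at hc
      have hgrow : s'.reg 13 < m → w[m - s'.reg 13 - 1]? = w[s'.reg 13]? →
          IsPal (fun k => w[k]?) (m - (s'.reg 13 + 1)) (s'.reg 13 + 1) :=
        fun h h' => hp'.grow (by omega) h h'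
      have hmax : (s'.reg 13 < w.length → s'.reg 13 < m →
          ¬ w[m - s'.reg 13 - 1]? = w[s'.reg 13]?) →
          rad (fun k => w[k]?) w.length m = s'.reg 13 :=
        rad_eq (by omega) hem hen hp'
      simp [block, vc, Test.Defined, Test.Holds, State.setReg_reg, State.setReg_mem,
        env_setReg_iff, hE'.r0, hE'.r1, h11', hc, hE', hm', h12'] at hb1 hb2 ⊢
      repeat' first | with_reducible apply And.intro | with_reducible intro _
      all_goals first
        | omega
        | exact hgrow ‹_› ‹_›
        | exact hmax fun _ _ => by assumption
    · simp only [Test.Holds, hE'.r1] at hc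
      have hfl0 : s'.reg 15 = 0 := by omega
      have := hr hfl0
      exact hQ _ _ hE' hm' h11' (by rw [this]) (by omega) h12' (by omega)

/-- Store register `17` as the right end for the centre in register `11`, and go on. -/
def recordProg : Prog := block [.add 16 2 11, .store 16 17, .add 11 11 1]

/-- Find the maximal palindrome with the centre in register `11`. Register `13` holds the
greatest right end found so far, and register `12` its centre. -/
def centreProg : Prog :=
  block [.add 14 13 13,
    -- If `2 * e < m` for the known right end `e`, then `m = 2 * e + 1`, and the one-letter
    -- palindrome `[e, e + 1)` is the starting point. Equating registers `17` and `13` makes the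
    -- next test fail, so that the extension loop is entered.
    .ite (.lt 14 11) (block [.add 13 13 1, .copy 17 13])
      (block [.add 17 12 12, .sub 17 17 11, .add 17 17 2, .load 17 17, .add 17 17 11,
        .sub 17 17 12]),
    .ite (.lt 17 13) recordProg
      (block [.copy 12 11, .const 15 1, extendProg, .copy 17 13, recordProg])]

/-- Store the right end of the maximal palindrome with centre `m` in cell `n + 2 + m`. -/
def manacherProg : Prog :=
  block [.const 11 1, .const 12 0, .const 13 0, .const 17 0, .store 2 17,
    .loop (.lt 11 9) centreProg]

/-- The invariant of the loop in `manacherProg`. -/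
structure ManacherInv {β : Type*} (f : ℕ → β) (n : ℕ) (s₀ : State) (b₀ : ℕ) (s : State)
    (b : ℕ) : Prop where
  env : Env n s
  pos : 1 ≤ s.reg 11
  le : s.reg 11 ≤ 2 * n + 1
  lt : s.reg 12 < s.reg 11
  eq : s.reg 13 = rad f n (s.reg 12)
  next : s.reg 11 ≤ 2 * s.reg 13 + 1
  radii : ∀ m, m < s.reg 11 → s.mem (n + 2 + m) = rad f n m
  frame : ∀ a, a < n + 2 ∨ 3 * (n + 2) ≤ a → s.mem a = s₀.mem a
  -- The right end in register `13` never decreases and is at most `n`, so all extensions together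
  -- cost at most `20 * n` on top of the constant cost per centre.
  budget : b₀ ≤ b + 60 * s.reg 11 + 20 * s.reg 13

theorem vc_record {α : Type u} {B b b' b₀ : ℕ} {w : List α} {s s' s₀ : State}
    {Q : State → ℕ → Prop}
    (hI : ManacherInv (fun k => w[k]?) w.length s₀ b₀ s' b') (hB : 12 * (w.length + 2) ≤ B)
    (hb₀ : 400 * (w.length + 1) ≤ b₀) (hc : s'.reg 11 < 2 * w.length + 1)
    (hE : Env w.length s) (h11 : s.reg 11 = s'.reg 11) (h12 : s.reg 12 ≤ s'.reg 11)
    (h13 : s.reg 13 = rad (fun k => w[k]?) w.length (s.reg 12))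
    (h17 : s.reg 17 = rad (fun k => w[k]?) w.length (s'.reg 11))
    (hnext : s'.reg 11 ≤ 2 * s.reg 13) (hmem : s.mem = s'.mem)
    (hb : b' + 20 * s'.reg 13 ≤ b + 50 + 20 * s.reg 13)
    (hQ : ∀ s₁ b₁, 2 ≤ b₁ → ManacherInv (fun k => w[k]?) w.length s₀ b₀ s₁ (b₁ - 2) → Q s₁ b₁) :
    vc B w recordProg Q s b := by
  have hrn := rad_le (f := fun k => w[k]?) (n := w.length) (m := s.reg 12)
  have := hI.budget
  rw [← h13] at hrn
  simp [recordProg, block, vc, State.setReg_reg, State.setMem_reg, hE.r2, hE.r1, h11, h17]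
  refine ⟨by omega, by omega, by omega, by omega, by omega, by omega, hQ _ _ (by omega) ?_⟩
  constructor <;> simp [State.setReg_reg, State.setReg_mem, State.setMem_reg, env_setReg_iff,
    env_setMem_iff, State.setMem_mem, hE]
  · omega
  · omega
  · exact h13
  · omega
  · intro m hm
    by_cases hm' : m = s'.reg 11
    · rw [if_pos hm', hm']
    · rw [if_neg hm', hmem, hI.radii m (by omega)]
  · intro a ha
    rw [if_neg (by omega), hmem, hI.frame a ha]
  · omega

theorem vc_centre {α : Type u} {B b b₀ : ℕ} {w : List α} {s s₀ : State}
    (hI : ManacherInv (fun k => w[k]?) w.length s₀ b₀ s (b + 1))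
    (hB : 12 * (w.length + 2) ≤ B)
    (hb₀ : 400 * (w.length + 1) ≤ b₀) (hc : s.reg 11 < 2 * w.length + 1) :
    vc B w centreProg (ManacherInv (fun k => w[k]?) w.length s₀ b₀) s b := by
  have hE := hI.env
  have hrn := rad_le (f := fun k => w[k]?) (n := w.length) (m := s.reg 12)
  obtain ⟨hr1, hr2, hr3⟩ := rad_spec (f := fun k => w[k]?) (n := w.length)
    (m := s.reg 12) (by have := hI.lt; omega)
  -- The mirror centre precedes the current one, so its radius is already stored.
  have hv : s.reg 11 ≤ 2 * s.reg 13 → s.mem (s.reg 12 + s.reg 12 - s.reg 11 + (w.length + 2)) =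
      rad (fun k => w[k]?) w.length (2 * s.reg 12 - s.reg 11) := by
    intro h
    have := hI.lt
    have h4 := hI.eq
    rw [← hI.radii _ (by omega)]
    congr 1
    omega
  have hlt := rad_mirror_lt (f := fun k => w[k]?) (n := w.length) (m := s.reg 11)
    (m₀ := s.reg 12) (by have := hI.lt; omega) hI.lt
  have hge := isPal_of_mirror (f := fun k => w[k]?) (n := w.length) (m := s.reg 11)
    (m₀ := s.reg 12) (by have := hI.lt; omega) hI.lt
  rw [← hI.eq] at hrn hr1 hr2 hr3 hlt hge
  generalize hvd : s.mem (s.reg 12 + s.reg 12 - s.reg 11 + (w.length + 2)) = v at hv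
  have hvn : s.reg 11 ≤ 2 * s.reg 13 → v ≤ w.length := fun h => (hv h).trans_le rad_le
  have hbud := hI.budget
  have h1 := hI.lt
  have h2 := hI.next
  -- Shared by the two ways of entering the extension loop: a centre beyond the known right end, and
  -- a mirror image that reaches the border.
  have hext : ∀ s₁ b₁, Env w.length s₁ → s₁.reg 11 = s.reg 11 → s₁.reg 12 = s.reg 11 →
      s₁.reg 15 = 1 → s₁.mem = s.mem → s.reg 13 ≤ s₁.reg 13 → s₁.reg 13 ≤ s.reg 11 →
      s.reg 11 ≤ 2 * s₁.reg 13 → s₁.reg 13 ≤ w.length →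
      IsPal (fun k => w[k]?) (s.reg 11 - s₁.reg 13) (s₁.reg 13) → b ≤ b₁ + 15 →
      vc B w extendProg (fun s' b' => 1 ≤ b' ∧ vc B w recordProg
        (fun s' b' => 1 ≤ b' ∧ 1 ≤ b' - 1 ∧
          ManacherInv (fun k => w[k]?) w.length s₀ b₀ s' (b' - 1 - 1))
        (s'.setReg 17 (s'.reg 13)) (b' - 1)) s₁ b₁ := by
    intro s₁ b₁ hE₁ k11 k12 k15 kmem k1 k2 k3 k4 k5 k6
    refine vc_extend hE₁ hB k11 rfl k15 k3 k2 k4 k5 (by omega) ?_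
    intro s₂ b₂ hE₂ hmem₂ l11 l13 l0 l12 l1
    have hspec := rad_spec (f := fun k => w[k]?) (n := w.length) (m := s.reg 11) (by omega)
    have hrn₂ := rad_le (f := fun k => w[k]?) (n := w.length) (m := s.reg 11)
    refine ⟨by omega, vc_record hI hB hb₀ hc ((env_setReg_iff (by omega)).2 hE₂) ?_ ?_ ?_ ?_ ?_
      ?_ ?_ ?_⟩ <;> try simp [State.setReg_reg, State.setReg_mem, l11, l12, l13, k12, hmem₂, kmem]
    · exact hspec.1
    · omega
    · exact fun s₁ b₁ h h' => ⟨by omega, by omega, by rwa [Nat.sub_sub]⟩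
  simp [centreProg, block, vc, State.setReg_reg, State.setReg_mem, hE.r1, hE.r2, Test.Defined,
    Test.Holds, hvd]
  refine ⟨by omega, by omega, by omega, fun hlong => ?_, fun hshort => ?_⟩
  · refine ⟨by omega, by omega, by omega, by omega, by omega, by omega, by omega, by omega,
      hext _ _ ?_ ?_ ?_ ?_ ?_ ?_ ?_ ?_ ?_ ?_ ?_⟩ <;>
      try simp [State.setReg_reg, State.setReg_mem, env_setReg_iff, hE]
    · omega
    · omega
    · omega
    · exact IsPal.of_le (by omega)
    · omega
  · have hshort' : s.reg 11 ≤ 2 * s.reg 13 := by omega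
    have hvn := hvn hshort'
    rw [← hv hshort'] at hlt hge
    refine ⟨by omega, by omega, by omega, by omega, by omega, by omega, by omega, by omega,
      by omega, by omega, by omega, fun hin => ?_, fun hout => ?_⟩
    · refine vc_record hI hB hb₀ hc ?_ ?_ ?_ ?_ ?_ ?_ ?_ ?_ ?_ <;>
        try simp [State.setReg_reg, State.setReg_mem, env_setReg_iff, hE]
      · omega
      · exact hI.eq
      · exact (hlt hshort' hin).symm
      · omega
      · omega
      · refine fun s₁ b₁ h h' => ⟨by omega, ?_⟩
        exact { h' with budget := by have := h'.budget; omega }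
    · refine ⟨by omega, by omega, by omega, hext _ _ ?_ ?_ ?_ ?_ ?_ ?_ ?_ ?_ ?_ ?_ ?_⟩ <;>
        try simp [State.setReg_reg, State.setReg_mem, env_setReg_iff, hE]
      · omega
      · omega
      · omega
      · exact hge hshort' hout
      · omega

theorem vc_manacher {α : Type u} {B b : ℕ} {w : List α} {s : State} {Q : State → ℕ → Prop}
    (hE : Env w.length s) (hB : 12 * (w.length + 2) ≤ B) (hb : 400 * (w.length + 1) ≤ b)
    (hQ : ∀ s' b', Env w.length s' →
      (∀ m ≤ 2 * w.length, s'.mem (w.length + 2 + m) = rad (fun k => w[k]?) w.length m) →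
      (∀ a, a < w.length + 2 ∨ 3 * (w.length + 2) ≤ a → s'.mem a = s.mem a) →
      b ≤ b' + 400 * (w.length + 1) → Q s' b') :
    vc B w manacherProg Q s b := by
  have h0 : rad (fun k => w[k]?) w.length 0 = 0 := by
    have := (rad_spec (f := fun k => w[k]?) (n := w.length) (m := 0) (by omega)).2.1
    omega
  simp only [manacherProg, block, vc, State.setReg_reg]
  refine ⟨by omega, by omega, by omega, by omega, by omega, by omega, by omega, by omega,
    by omega, ManacherInv (fun k => w[k]?) w.length s b, ?_, ?_⟩
  · constructor <;> simp [State.setReg_reg, State.setReg_mem, State.setMem_reg, env_setReg_iff,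
      env_setMem_iff, State.setMem_mem, hE, hE.r2, h0]
    · omega
    · omega
  · intro s' b' hI
    have hb1 := hI.budget
    have hb2 := hI.le
    have hb3 := rad_le (f := fun k => w[k]?) (n := w.length) (m := s'.reg 12)
    rw [← hI.eq] at hb3
    refine ⟨trivial, by omega, fun hc => ?_, fun hc => ?_⟩
    · simp only [Test.Holds, hI.env.r9] at hc
      refine vc_centre ?_ hB hb hc
      rwa [Nat.sub_add_cancel (by omega)]
    · simp only [Test.Holds, hI.env.r9] at hc
      exact ⟨by omega, hQ _ _ hI.env (fun m hm => hI.radii m (by omega)) hI.frame (by omega)⟩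

/-! ## Nearest covering centres, with a stack -/

/-- Drop the centres on top of the stack whose right ends lie before the position in
register `11`. -/
def popProg : Prog :=
  .loop (.eq 15 1) (block [.const 15 0,
    .ite (.lt 4 12)
      (block [.sub 14 12 1, .load 17 14, .add 17 17 20, .load 17 17,
        .ite (.lt 17 11) (block [.copy 12 14, .const 15 1]) .skip])
      .skip])

/-- The stack in the cells from `5 * (n + 2)` on, below the cell in register `12`, is sorted, and
contains all `m` with `m + 2 ≤ 2 * e` and `e ≤ A m`. -/
structure CentreStack (A : ℕ → ℕ) (n e : ℕ) (s : State) : Prop where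
  bot : 5 * (n + 2) ≤ s.reg 12
  top : s.reg 12 ≤ 5 * (n + 2) + 2 * e
  lt : ∀ j, 5 * (n + 2) ≤ j → j < s.reg 12 → s.mem j + 2 ≤ 2 * e
  mono : ∀ i j, 5 * (n + 2) ≤ i → i ≤ j → j < s.reg 12 → s.mem i ≤ s.mem j
  complete : ∀ m, m + 2 ≤ 2 * e → e ≤ A m → ∃ j, 5 * (n + 2) ≤ j ∧ j < s.reg 12 ∧ s.mem j = m

/-- The invariant of the loop in `popProg`. -/
structure PopInv (A : ℕ → ℕ) (n e : ℕ) (s₀ : State) (b₀ : ℕ) (s : State) (b : ℕ) : Prop where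
  env : Env n s
  stack : CentreStack A n e s
  mem : s.mem = s₀.mem
  r11 : s.reg 11 = e
  r13 : s.reg 13 = s₀.reg 13
  r20 : s.reg 20 = s₀.reg 20
  r21 : s.reg 21 = s₀.reg 21
  flag : s.reg 15 ≤ 1
  done : s.reg 15 = 0 → 5 * (n + 2) < s.reg 12 → e ≤ A (s.mem (s.reg 12 - 1))
  budget : b₀ + 15 * s.reg 12 + 12 * s.reg 15 ≤ b + 15 * s₀.reg 12 + 12

/-- Each pop is charged `15` steps against the drop in the height of the stack. Only the top entry
is guaranteed to reach `e` afterwards; deeper entries may be stale, and are removed when they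
surface. -/
theorem vc_pop {α : Type u} {B b n e a : ℕ} {w : List α} {s : State} {Q : State → ℕ → Prop}
    {A : ℕ → ℕ} (hE : Env n s) (hB : 12 * (n + 2) ≤ B) (he : e ≤ n)
    (ha : a + 2 * (n + 2) ≤ 5 * (n + 2)) (hA : ∀ m ≤ 2 * n, s.mem (a + m) = A m)
    (hs : CentreStack A n e s) (h11 : s.reg 11 = e) (h15 : s.reg 15 = 1) (h20 : s.reg 20 = a)
    (hb : 15 * s.reg 12 + 20 ≤ b + 15 * (5 * (n + 2)))
    (hQ : ∀ s' b', 1 ≤ b' → PopInv A n e s b s' b' → s'.reg 15 = 0 → Q s' (b' - 1)) :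
    vc B w popProg Q s b := by
  refine ⟨PopInv A n e s b, ?_, ?_⟩
  · exact ⟨hE, hs, rfl, h11, rfl, rfl, rfl, h15.le, by omega, by omega⟩
  · intro s' b' hI
    have hE' := hI.env
    have hf := hI.flag
    have hbud := hI.budget
    have hbot := hI.stack.bot
    have htop := hI.stack.top
    refine ⟨trivial, by omega, fun hc => ?_, fun hc => ?_⟩
    · simp only [Test.Holds, hE'.r1] at hc
      have hmem := hI.mem
      have hlt := hI.stack.lt (s'.reg 12 - 1)
      have hAt : 5 * (n + 2) < s'.reg 12 → s'.mem (s'.mem (s'.reg 12 - 1) + a) =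
          A (s'.mem (s'.reg 12 - 1)) := by
        intro h
        rw [← hA _ (by omega), add_comm a, hmem]
      simp [block, vc, Test.Defined, Test.Holds, State.setReg_reg, State.setReg_mem, hE'.r1,
        hE'.r4, hI.r11, hI.r20, h20]
      refine ⟨by omega, by omega, by omega, fun h => ⟨by omega, by omega, by omega, by omega,
        by omega, by omega, fun h' => ?_, fun h' => ?_⟩, fun h => ?_⟩
      · refine ⟨by omega, by omega, by omega, by omega, by omega, by omega, ?_⟩
        constructor <;> try simp [State.setReg_reg, State.setReg_mem, env_setReg_iff, hE',
          hI.mem, hI.r11, hI.r13, hI.r20, hI.r21]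
        · constructor <;> try simp [State.setReg_reg, State.setReg_mem]
          · omega
          · omega
          · exact fun j h1 h2 => hI.stack.lt j h1 (by omega)
          · exact fun i j h1 h2 h3 => hI.stack.mono i j h1 h2 (by omega)
          · intro m h1 h2
            obtain ⟨j, h3, h4, rfl⟩ := hI.stack.complete m h1 h2
            refine ⟨j, h3, ?_, rfl⟩
            by_contra h5
            rw [show j = s'.reg 12 - 1 by omega] at h2
            have := hAt h
            omega
        · omega
      · refine ⟨by omega, by omega, by omega, ?_⟩
        constructor <;> try simp [State.setReg_reg, State.setReg_mem, env_setReg_iff, hE',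
          hI.mem, hI.r11, hI.r13, hI.r20, hI.r21]
        · exact ⟨hI.stack.bot, hI.stack.top, hI.stack.lt, hI.stack.mono, hI.stack.complete⟩
        · have := hAt h
          simp only [hmem] at this h' ⊢
          omega
        · omega
      · refine ⟨by omega, by omega, ?_⟩
        constructor <;> try simp [State.setReg_reg, State.setReg_mem, env_setReg_iff, hE',
          hI.mem, hI.r11, hI.r13, hI.r20, hI.r21]
        · exact ⟨hI.stack.bot, hI.stack.top, hI.stack.lt, hI.stack.mono, hI.stack.complete⟩
        · omega
        · omega
    · simp only [Test.Holds, hE'.r1] at hc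
      exact hQ _ _ (by omega) hI (by omega)

/-- Store `topCode A e` for the position `e` in register `11`, and go on. -/
def topProg : Prog :=
  block [.add 13 11 11, .const 14 3, .sub 14 13 14, .store 12 14, .add 12 12 1, .const 14 2,
    .sub 14 13 14, .store 12 14, .add 12 12 1, .const 15 1, popProg, .add 16 21 11,
    .ite (.lt 4 12)
      (block [.sub 14 12 1, .load 14 14, .add 13 13 1, .sub 13 13 14, .store 16 13])
      (block [.const 14 0, .store 16 14]),
    .add 11 11 1]

/-- Given the numbers `A m` in the cells from the one in register `20` on, store `topCode A e`
for `1 ≤ e ≤ n` in the cells from the one in register `21` on. -/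
def coverProg : Prog :=
  block [.const 11 1, .copy 12 4, .loop (.lt 11 10) topProg]

/-- The invariant of the loop in `coverProg`. -/
structure CoverInv (A : ℕ → ℕ) (n a o : ℕ) (s₀ : State) (b₀ : ℕ) (s : State) (b : ℕ) :
    Prop where
  env : Env n s
  pos : 1 ≤ s.reg 11
  le : s.reg 11 ≤ n + 1
  r20 : s.reg 20 = a
  r21 : s.reg 21 = o
  stack : CentreStack A n (s.reg 11 - 1) s
  out : ∀ e, 1 ≤ e → e < s.reg 11 → s.mem (o + e) = topCode A e
  frame : ∀ x, (x < 5 * (n + 2) ∨ 7 * (n + 2) ≤ x) → (x ≤ o ∨ o + n < x) → s.mem x = s₀.mem x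
  budget : b₀ + 15 * s.reg 12 ≤ b + 15 * (5 * (n + 2)) + 100 * s.reg 11

/-- Moving from `e - 1` to `e` admits only the new centres `2 * e - 3` and `2 * e - 2`, while `e ≤ A
m` implies `e - 1 ≤ A m` for the old ones. At `e = 1` truncated subtraction pushes `0` twice, which
is harmless because the order in `mono` is not strict. -/
theorem CentreStack.push {A : ℕ → ℕ} {n e : ℕ} {s s' : State} (h : CentreStack A n (e - 1) s)
    (he : 1 ≤ e) (h12 : s'.reg 12 = s.reg 12 + 2) (h0 : ∀ j < s.reg 12, s'.mem j = s.mem j)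
    (h1 : s'.mem (s.reg 12) = 2 * e - 3) (h2 : s'.mem (s.reg 12 + 1) = 2 * e - 2) :
    CentreStack A n e s' := by
  have hb := h.bot
  have ht := h.top
  refine ⟨by omega, by omega, fun j k1 k2 => ?_, fun i j k1 k2 k3 => ?_, fun m k1 k2 => ?_⟩
  · rcases (show j < s.reg 12 ∨ j = s.reg 12 ∨ j = s.reg 12 + 1 by omega) with hj | rfl | rfl
    · rw [h0 j hj]
      have := h.lt j k1 hj
      omega
    · omega
    · omega
  · rcases (show j < s.reg 12 ∨ j = s.reg 12 ∨ j = s.reg 12 + 1 by omega) with hj | rfl | rfl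
    · rw [h0 j hj, h0 i (by omega)]
      exact h.mono i j k1 k2 hj
    · rcases Nat.eq_or_lt_of_le k2 with rfl | k4
      · exact le_rfl
      · rw [h0 i k4]
        have := h.lt i k1 k4
        omega
    · rcases (show i < s.reg 12 ∨ i = s.reg 12 ∨ i = s.reg 12 + 1 by omega) with hj | rfl | rfl
      · rw [h0 i hj]
        have := h.lt i k1 hj
        omega
      · omega
      · omega
  · by_cases k3 : m = 2 * e - 2
    · exact ⟨s.reg 12 + 1, by omega, by omega, by omega⟩
    · by_cases k4 : m = 2 * e - 3
      · exact ⟨s.reg 12, by omega, by omega, by omega⟩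
      · obtain ⟨j, l1, l2, l3⟩ := h.complete m (by omega) (by omega)
        exact ⟨j, l1, by omega, by rw [h0 j l2, l3]⟩

/-- The stack is sorted and misses no candidate, so a top entry that reaches `e` is the largest
centre that does. -/
theorem CentreStack.topCode_eq {A : ℕ → ℕ} {n e : ℕ} {s : State} (h : CentreStack A n e s)
    (hlt : 5 * (n + 2) < s.reg 12) (hA : e ≤ A (s.mem (s.reg 12 - 1))) :
    topCode A e = 2 * e + 1 - s.mem (s.reg 12 - 1) := by
  refine PalEnc.topCode_eq (h.lt _ (by omega) (by omega)) hA fun m h1 h2 => ?_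
  by_contra! h3
  obtain ⟨j, k1, k2, rfl⟩ := h.complete m h2 h3
  have := h.mono j (s.reg 12 - 1) k1 (by omega) (by omega)
  omega

theorem CentreStack.topCode_eq_zero {A : ℕ → ℕ} {n e : ℕ} {s : State}
    (h : CentreStack A n e s) (hlt : s.reg 12 ≤ 5 * (n + 2)) : topCode A e = 0 := by
  refine PalEnc.topCode_eq_zero fun m h2 => ?_
  by_contra! h3
  obtain ⟨j, k1, k2, rfl⟩ := h.complete m h2 h3
  omega

theorem vc_top {α : Type u} {B b b₀ n a o : ℕ} {w : List α} {s s₀ : State} {A : ℕ → ℕ}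
    (hI : CoverInv A n a o s₀ b₀ s (b + 1)) (hB : 12 * (n + 2) ≤ B)
    (ha : a + 2 * (n + 2) ≤ 5 * (n + 2)) (ho : 7 * (n + 2) ≤ o) (ho' : o ≤ 10 * (n + 2))
    (hA : ∀ m ≤ 2 * n, s₀.mem (a + m) = A m) (hb₀ : 400 * (n + 1) ≤ b₀) (hc : s.reg 11 ≤ n) :
    vc B w topProg (CoverInv A n a o s₀ b₀) s b := by
  have hE := hI.env
  have hbud := hI.budget
  have hpos := hI.pos
  have hbot := hI.stack.bot
  have htop := hI.stack.top
  simp [topProg, block, vc, State.setReg_reg, State.setMem_reg, hE.r1]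
  refine ⟨by omega, by omega, by omega, by omega, by omega, by omega, by omega, by omega,
    by omega, by omega, by omega, by omega, by omega, by omega, by omega, by omega, ?_⟩
  refine vc_pop (A := A) (e := s.reg 11) (a := a) (by simpa [env_setReg_iff, env_setMem_iff])
    hB hc ha ?_ ?_ ?_ ?_ ?_ ?_ ?_ <;>
    try simp [State.setReg_reg, State.setMem_reg, State.setReg_mem, State.setMem_mem]
  · intro m hm
    rw [if_neg (by omega), if_neg (by omega), hI.frame _ (by omega) (by omega), hA m hm]
  · refine hI.stack.push hpos ?_ ?_ ?_ ?_ <;>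
      try simp [State.setReg_reg, State.setReg_mem, State.setMem_mem]
    · intro j hj
      rw [if_neg (by omega), if_neg (by omega)]
    · omega
    · omega
  · exact hI.r20
  · omega
  · intro s' b' hb' hP hflag
    have hE' := hP.env
    have p11 := hP.r11
    have p13 := hP.r13
    have p20 := hP.r20
    have p21 := hP.r21
    have pbud := hP.budget
    have pbot := hP.stack.bot
    have ptop := hP.stack.top
    simp [State.setReg_reg, State.setMem_reg, hI.r20, hI.r21] at p13 p20 p21 pbud
    have hkey : ∀ s₁ b₁ x, Env n s₁ → s₁.reg 11 = s.reg 11 + 1 → s₁.reg 12 = s'.reg 12 →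
        s₁.reg 20 = a → s₁.reg 21 = o →
        s₁.mem = (s'.setMem (o + s.reg 11) x).mem → x = topCode A (s.reg 11) →
        b' ≤ b₁ + 20 → CoverInv A n a o s₀ b₀ s₁ b₁ := by
      intro s₁ b₁ x hE₁ k11 k12 k20 k21 kmem kx kb
      refine ⟨hE₁, by omega, by omega, k20, k21, ?_, ?_, ?_, by omega⟩
      · rw [k11, Nat.add_sub_cancel]
        have hj : ∀ j < s'.reg 12, s₁.mem j = s'.mem j := by
          intro j hj
          rw [kmem, State.setMem_mem, if_neg (by omega)]
        have hS := hP.stack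
        refine ⟨by rw [k12]; exact hS.bot, by rw [k12]; exact hS.top, ?_, ?_, ?_⟩
        · intro j h1 h2
          rw [k12] at h2
          rw [hj j h2]
          exact hS.lt j h1 h2
        · intro i j h1 h2 h3
          rw [k12] at h3
          rw [hj j h3, hj i (by omega)]
          exact hS.mono i j h1 h2 h3
        · intro m h1 h2
          obtain ⟨j, h3, h4, h5⟩ := hS.complete m h1 h2
          exact ⟨j, h3, by omega, by rw [hj j h4, h5]⟩
      · intro e h1 h2
        rw [kmem, State.setMem_mem]
        by_cases h3 : e = s.reg 11
        · rw [h3, if_pos rfl, kx]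
        · rw [if_neg (by omega), hP.mem]
          simp only [State.setReg_mem, State.setMem_mem]
          rw [if_neg (by omega), if_neg (by omega), hI.out e h1 (by omega)]
      · intro x h1 h2
        rw [kmem, State.setMem_mem, if_neg (by omega), hP.mem]
        simp only [State.setReg_mem, State.setMem_mem]
        rw [if_neg (by omega), if_neg (by omega), hI.frame x h1 h2]
    simp [hE'.r4, hE'.r1, p11, p13, p21, Test.Defined, Test.Holds,
      State.setReg_reg]
    refine ⟨by omega, by omega, by omega, fun hlt => ?_, fun hge => ?_⟩
    · have hcode := hP.stack.topCode_eq hlt (hP.done hflag hlt)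
      refine ⟨by omega, by omega, by omega, by omega, by omega, by omega, by omega, by omega,
        by omega, by omega, hkey _ _ _ ?_ ?_ ?_ ?_ ?_ rfl ?_ ?_⟩ <;>
      try simp [State.setReg_reg, State.setMem_reg, env_setReg_iff, env_setMem_iff, hE', p20,
        p21]
      · omega
      · omega
    · have hcode := hP.stack.topCode_eq_zero hge
      refine ⟨by omega, by omega, by omega, by omega, by omega, by omega, by omega,
        hkey _ _ _ ?_ ?_ ?_ ?_ ?_ rfl ?_ ?_⟩ <;>
      try simp [State.setReg_reg, State.setMem_reg, env_setReg_iff, env_setMem_iff, hE', p20,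
        p21, hcode]
      omega

theorem vc_cover {α : Type u} {B b n a o : ℕ} {w : List α} {s : State} {A : ℕ → ℕ}
    {Q : State → ℕ → Prop} (hE : Env n s) (hB : 12 * (n + 2) ≤ B)
    (h20 : s.reg 20 = a) (h21 : s.reg 21 = o)
    (ha : a + 2 * (n + 2) ≤ 5 * (n + 2)) (ho : 7 * (n + 2) ≤ o) (ho' : o ≤ 10 * (n + 2))
    (hA : ∀ m ≤ 2 * n, s.mem (a + m) = A m) (hb : 400 * (n + 1) ≤ b)
    (hQ : ∀ s' b', Env n s' →
      (∀ e, 1 ≤ e → e ≤ n → s'.mem (o + e) = topCode A e) →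
      (∀ x, (x < 5 * (n + 2) ∨ 7 * (n + 2) ≤ x) → (x ≤ o ∨ o + n < x) → s'.mem x = s.mem x) →
      b ≤ b' + 400 * (n + 1) → Q s' b') :
    vc B w coverProg Q s b := by
  simp only [coverProg, block, vc]
  refine ⟨by omega, by omega, by omega, CoverInv A n a o s b, ?_, ?_⟩
  · constructor <;> try simp [State.setReg_reg, State.setReg_mem, env_setReg_iff, hE, h20, h21]
    · constructor <;> try simp [State.setReg_reg, State.setReg_mem, hE.r4]
      omega
    · intros
      omega
    · rw [hE.r4]
      omega
  · intro s' b' hI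
    have hbud := hI.budget
    have hle := hI.le
    have hbot := hI.stack.bot
    refine ⟨trivial, by omega, fun hc => ?_, fun hc => ?_⟩
    · simp only [Test.Holds, hI.env.r10] at hc
      refine vc_top ?_ hB ha ho ho' hA hb (by omega)
      rwa [Nat.sub_add_cancel (by omega)]
    · simp only [Test.Holds, hI.env.r10] at hc
      exact ⟨by omega, hQ _ _ hI.env (fun e h1 h2 => hI.out e h1 (by omega)) hI.frame
        (by omega)⟩

/-! ## Reversal, counting, and output -/

/-- From `R m` in cell `n + 2 + m`, store `R (2 * n - m) + m - n` in cell `3 * (n + 2) + m`. -/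
def reverseProg : Prog :=
  block [.const 11 0, .loop (.lt 11 9) (block [.add 13 0 0, .sub 13 13 11, .add 13 13 2,
    .load 13 13, .add 13 13 11, .sub 13 13 0, .add 14 3 11, .store 14 13, .add 11 11 1])]

theorem vc_reverse {α : Type u} {B b n : ℕ} {w : List α} {s : State} {R : ℕ → ℕ}
    {Q : State → ℕ → Prop} (hE : Env n s) (hB : 12 * (n + 2) ≤ B)
    (hR : ∀ m ≤ 2 * n, s.mem (n + 2 + m) = R m) (hRn : ∀ m, R m ≤ n) (hb : 400 * (n + 1) ≤ b)
    (hQ : ∀ s' b', Env n s' →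
      (∀ m ≤ 2 * n, s'.mem (3 * (n + 2) + m) = R (2 * n - m) + m - n) →
      (∀ x, (x < 3 * (n + 2) ∨ 5 * (n + 2) ≤ x) → s'.mem x = s.mem x) →
      b ≤ b' + 400 * (n + 1) → Q s' b') :
    vc B w reverseProg Q s b := by
  refine ⟨by omega, by omega, fun s' b' => Env n s' ∧ s'.reg 11 ≤ 2 * n + 1 ∧
    (∀ m < s'.reg 11, s'.mem (3 * (n + 2) + m) = R (2 * n - m) + m - n) ∧
    (∀ x, (x < 3 * (n + 2) ∨ 5 * (n + 2) ≤ x) → s'.mem x = s.mem x) ∧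
    b ≤ b' + 2 + 20 * s'.reg 11, ?_, ?_⟩
  · simp [State.setReg_reg, State.setReg_mem, env_setReg_iff, hE]
    omega
  · rintro s' b' ⟨hE', hle, hout, hfr, hbud⟩
    refine ⟨trivial, by omega, fun hc => ?_, fun hc => ?_⟩
    · simp only [Test.Holds, hE'.r9] at hc
      have hld : s'.mem (n + n - s'.reg 11 + (n + 2)) = R (2 * n - s'.reg 11) := by
        rw [← hR _ (by omega), hfr _ (by omega)]
        congr 1
        omega
      have := hRn (2 * n - s'.reg 11)
      simp [block, vc, State.setReg_reg, State.setReg_mem, State.setMem_reg, hE'.r0, hE'.r1,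
        hE'.r2, hE'.r3, env_setReg_iff, env_setMem_iff, hE', hld, State.setMem_mem]
      refine ⟨by omega, by omega, by omega, by omega, by omega, by omega, by omega, by omega,
        by omega, by omega, by omega, by omega, by omega, by omega, by omega, by omega,
        fun m hm => ?_, fun x hx => ?_, by omega⟩
      · split_ifs with h
        · rw [h]
        · exact hout m (by omega)
      · rw [if_neg (by omega), hfr x hx]
    · simp only [Test.Holds, hE'.r9] at hc
      exact ⟨by omega, hQ _ _ hE' (fun m hm => hout m (by omega)) hfr (by omega)⟩

/-- Initialize the counters. -/
def initProg : Prog :=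
  -- The group extended by the next character is counted in advance. The second counter starts at
  -- `2`: one for that group in its own rank, one for the shift made by `code`.
  block [.const 11 1, .const 12 0, .const 17 2, .loop (.lt 11 10) (block [.add 13 5 11,
    .load 13 13,
    .ite (.eq 13 12) .skip (block [.add 14 7 11, .sub 14 14 1, .store 14 1, .add 14 8 11,
      .store 14 17]),
    .add 11 11 1])]

/-- The invariant of the loop in `initProg`. -/
structure InitInv (S : ℕ → ℕ) (n : ℕ) (s₀ : State) (b₀ : ℕ) (s : State) (b : ℕ) : Prop where
  env : Env n s
  pos : 1 ≤ s.reg 11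
  le : s.reg 11 ≤ n + 1
  r12 : s.reg 12 = 0
  r17 : s.reg 17 = 2
  cntG : ∀ i ≤ n, s.mem (9 * (n + 2) + i) = if i + 1 < s.reg 11 ∧ S (i + 1) ≠ 0 then 1 else 0
  cntT : ∀ i ≤ n, s.mem (10 * (n + 2) + i + 1) =
    if i + 1 < s.reg 11 ∧ S (i + 1) ≠ 0 then 2 else 0
  frame : ∀ x < 9 * (n + 2), s.mem x = s₀.mem x
  budget : b₀ ≤ b + 20 * s.reg 11

theorem vc_init {α : Type u} {B b n : ℕ} {w : List α} {s : State} {S : ℕ → ℕ}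
    {Q : State → ℕ → Prop} (hE : Env n s) (hB : 12 * (n + 2) ≤ B)
    (hS : ∀ e ≤ n + 1, s.mem (7 * (n + 2) + e) = S e) (hS' : S (n + 1) = 0)
    (hz : ∀ x, 9 * (n + 2) ≤ x → s.mem x = 0) (hb : 400 * (n + 1) ≤ b)
    (hQ : ∀ s' b', Env n s' →
      (∀ i ≤ n, s'.mem (9 * (n + 2) + i) = if S (i + 1) = 0 then 0 else 1) →
      (∀ i ≤ n, s'.mem (10 * (n + 2) + i + 1) = if S (i + 1) = 0 then 0 else 2) →
      (∀ x < 9 * (n + 2), s'.mem x = s.mem x) →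
      b ≤ b' + 400 * (n + 1) → Q s' b') :
    vc B w initProg Q s b := by
  simp only [initProg, block, vc]
  refine ⟨by omega, by omega, by omega, by omega, by omega, by omega,
    InitInv S n s b, ?_, ?_⟩
  · constructor <;> try simp [State.setReg_reg, State.setReg_mem, env_setReg_iff, hE]
    · exact fun i _ => hz _ (by omega)
    · exact fun i _ => hz _ (by omega)
    · omega
  · intro s' b' hI
    have hE' := hI.env
    have hpos := hI.pos
    have hle := hI.le
    have hbud := hI.budget
    refine ⟨trivial, by omega, fun hc => ?_, fun hc => ?_⟩
    · simp only [Test.Holds, hE'.r10] at hc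
      have hld : s'.mem (7 * (n + 2) + s'.reg 11) = S (s'.reg 11) := by
        rw [← hS _ (by omega), hI.frame _ (by omega)]
      simp [Test.Defined, Test.Holds, State.setReg_reg, State.setReg_mem,
        State.setMem_reg, hE'.r1, hE'.r5, hE'.r7, hE'.r8, hI.r12, hI.r17, hld]
      refine ⟨by omega, by omega, by omega, by omega, fun h => ⟨by omega, by omega, by omega,
        by omega, ?_⟩, fun h => ⟨by omega, by omega, by omega, by omega, by omega, by omega,
        by omega, by omega, by omega, by omega, by omega, ?_⟩⟩
      · constructor <;> try simp [State.setReg_reg, State.setReg_mem, env_setReg_iff, hE']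
        · omega
        · exact hI.r12
        · exact hI.r17
        · intro i hi
          rw [hI.cntG i hi]
          by_cases h' : i + 1 = s'.reg 11
          · simp [h', h]
          · congr 1
            apply propext
            omega
        · intro i hi
          rw [hI.cntT i hi]
          by_cases h' : i + 1 = s'.reg 11
          · simp [h', h]
          · congr 1
            apply propext
            omega
        · exact hI.frame
        · omega
      · constructor <;> try simp [State.setReg_reg, State.setReg_mem, env_setReg_iff, hE',
          State.setMem_reg, State.setMem_mem, env_setMem_iff]
        · omega
        · exact hI.r12
        · exact hI.r17
        · intro i hi
          rw [hI.cntG i hi, if_neg (by omega)]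
          by_cases h' : i + 1 = s'.reg 11
          · rw [if_pos (by omega)]
            simp [h', h]
            omega
          · rw [if_neg (by omega)]
            congr 1
            apply propext
            omega
        · intro i hi
          rw [hI.cntT i hi]
          by_cases h' : i + 1 = s'.reg 11
          · rw [if_pos (by omega)]
            simp [h', h]
            omega
          · rw [if_neg (by omega), if_neg (by omega)]
            congr 1
            apply propext
            omega
        · intro x hx
          rw [if_neg (by omega), if_neg (by omega), hI.frame x hx]
        · omega
    · simp only [Test.Holds, hE'.r10] at hc
      refine ⟨by omega, hQ _ _ hE' (fun i hi => ?_) (fun i hi => ?_) hI.frame (by omega)⟩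
      · rw [hI.cntG i hi]
        by_cases h : S (i + 1) = 0
        · simp [h]
        -- The loop stops before position `n + 1`, so the entry for `i = n` is right only because `S
        -- (n + 1) = 0`.
        · have : i ≠ n := by rintro rfl; exact h hS'
          rw [if_neg h, if_pos ⟨by omega, h⟩]
      · rw [hI.cntT i hi]
        by_cases h : S (i + 1) = 0
        · simp [h]
        · have : i ≠ n := by rintro rfl; exact h hS'
          rw [if_neg h, if_pos ⟨by omega, h⟩]

/-- The left char of the maximal palindrome with centre `m` occurs to the left of no shorter
suffix-palindrome, in terms of the codes `S'` of the shortest prefix-palindromes. -/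
abbrev IsFresh (R S' : ℕ → ℕ) (n m : ℕ) : Prop :=
  -- With `s = m - R m`, a palindrome starting at `s - 1` ends by `R m` exactly when its length is
  -- at most `R m - s + 1`; its code is one more than its length. For `s = 0` the index is `n + 1`,
  -- where the code is `0` and the test succeeds.
  S' (n + 1 - (m - R m)) = 0 ∨ R m - (m - R m) + 2 < S' (n + 1 - (m - R m))

/-- The maximal palindrome with centre `m` is shorter than the one that is extended next. -/
abbrev IsBelow (R S : ℕ → ℕ) (m : ℕ) : Prop := R m - (m - R m) + 3 < S (R m + 1)

/-- Count the maximal palindrome with right end in register `13` and length in register `17`. -/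
def tallyProg : Prog :=
  block [.add 19 7 13, .load 18 19, .add 18 18 1, .store 19 18, .const 18 3, .add 17 17 18,
    .add 19 5 13, .add 19 19 1, .load 19 19,
    .ite (.lt 17 19) (block [.add 19 8 13, .add 19 19 1, .load 18 19, .add 18 18 1,
      .store 19 18]) .skip]

/-- Count the maximal palindromes. -/
def countProg : Prog :=
  block [.const 11 0, .loop (.lt 11 9) (block [.add 13 2 11, .load 13 13, .sub 14 11 13,
    .sub 16 10 14, .add 16 16 6, .load 16 16, .sub 17 13 14, .const 18 2, .add 18 17 18,
    .const 15 0,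
    .ite (.eq 16 15) tallyProg (.ite (.lt 18 16) tallyProg .skip),
    .add 11 11 1])]

/-- The number of steps that have increased the first counter for the position `i`. -/
def tallyG (R S' : ℕ → ℕ) (n k i : ℕ) : ℕ :=
  ((Finset.range k).filter fun m => R m = i ∧ IsFresh R S' n m).card

/-- The number of steps that have increased the second counter for the position `i`. -/
def tallyT (R S S' : ℕ → ℕ) (n k i : ℕ) : ℕ :=
  ((Finset.range k).filter fun m => R m = i ∧ IsFresh R S' n m ∧ IsBelow R S m).card

theorem tallyG_succ (R S' : ℕ → ℕ) (n k i : ℕ) : tallyG R S' n (k + 1) i =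
    tallyG R S' n k i + if R k = i ∧ IsFresh R S' n k then 1 else 0 := by
  unfold tallyG
  rw [Finset.range_add_one, Finset.filter_insert]
  split_ifs with h
  · rw [Finset.card_insert_of_notMem (by simp)]
  · rfl

theorem tallyT_succ (R S S' : ℕ → ℕ) (n k i : ℕ) : tallyT R S S' n (k + 1) i =
    tallyT R S S' n k i + if R k = i ∧ IsFresh R S' n k ∧ IsBelow R S k then 1 else 0 := by
  unfold tallyT
  rw [Finset.range_add_one, Finset.filter_insert]
  split_ifs with h
  · rw [Finset.card_insert_of_notMem (by simp)]
  · rfl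

theorem tallyG_le (R S' : ℕ → ℕ) (n k i : ℕ) : tallyG R S' n k i ≤ k :=
  (Finset.card_filter_le _ _).trans_eq (Finset.card_range k)

theorem tallyT_le (R S S' : ℕ → ℕ) (n k i : ℕ) : tallyT R S S' n k i ≤ k :=
  (Finset.card_filter_le _ _).trans_eq (Finset.card_range k)

/-- The invariant of the loop in `countProg`. -/
structure CountInv (R S S' : ℕ → ℕ) (n : ℕ) (s₀ : State) (b₀ : ℕ) (s : State) (b : ℕ) :
    Prop where
  env : Env n s
  le : s.reg 11 ≤ 2 * n + 1
  cntG : ∀ i ≤ n, s.mem (9 * (n + 2) + i) =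
    (if S (i + 1) = 0 then 0 else 1) + tallyG R S' n (s.reg 11) i
  cntT : ∀ i ≤ n, s.mem (10 * (n + 2) + i + 1) =
    (if S (i + 1) = 0 then 0 else 2) + tallyT R S S' n (s.reg 11) i
  frame : ∀ x < 9 * (n + 2), s.mem x = s₀.mem x
  budget : b₀ ≤ b + 2 + 60 * s.reg 11

theorem vc_tally {α : Type u} {B b k b' b₀ n : ℕ} {w : List α} {s s' s₀ : State}
    {R S S' : ℕ → ℕ} {Q : State → ℕ → Prop} (hI : CountInv R S S' n s₀ b₀ s' b')
    (hB : 12 * (n + 2) ≤ B) (hb₀ : 400 * (n + 1) ≤ b₀) (hE : Env n s)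
    (hRn : R k ≤ n) (hS : ∀ e ≤ n + 1, s'.mem (7 * (n + 2) + e) = S e)
    (hk : s'.reg 11 = k) (hkn : k ≤ 2 * n) (hmem : s.mem = s'.mem) (h11 : s.reg 11 = k)
    (h13 : s.reg 13 = R k)
    (h17 : s.reg 17 = R k - (k - R k)) (hfresh : IsFresh R S' n k) (hb : b' ≤ b + 25)
    (hQ : ∀ s₁ b₁, CountInv R S S' n s₀ b₀ (s₁.setReg 11 (k + 1)) (b₁ - 5) →
      s₁.reg 1 = 1 → s₁.reg 11 = k → 5 ≤ b₁ → Q s₁ b₁) :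
    vc B w tallyProg Q s b := by
  have hbud := hI.budget
  have hG := hI.cntG (R k) hRn
  have hT := hI.cntT (R k) hRn
  rw [hk] at hG hT
  have hGle := tallyG_le R S' n k (R k)
  have hTle := tallyT_le R S S' n k (R k)
  have hG2 : s'.mem (9 * (n + 2) + R k) + 1 < B := by
    rw [hG]
    split_ifs <;> omega
  have hT2 : s'.mem (10 * (n + 2) + R k + 1) + 1 < B := by
    rw [hT]
    split_ifs <;> omega
  have hld : s'.mem (7 * (n + 2) + R k + 1) = S (R k + 1) := hS (R k + 1) (by omega)
  have hne₁ : 7 * (n + 2) + R k + 1 ≠ 9 * (n + 2) + R k := by omega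
  have hne₂ : 10 * (n + 2) + R k + 1 ≠ 9 * (n + 2) + R k := by omega
  simp [tallyProg, block, vc, Test.Defined, Test.Holds, State.setReg_reg, State.setReg_mem,
    State.setMem_reg, State.setMem_mem, hE.r1, hE.r5, hE.r7, hE.r8, h13, h17, hmem, hld,
    hne₁, hne₂]
  refine ⟨by omega, by omega, by omega, by omega, by omega, by omega, by omega, by omega,
    by omega, by omega, by omega, by omega, by omega, by omega, by omega, by omega,
    fun h => ⟨by omega, by omega, by omega, by omega, by omega, by omega, by omega, by omega,
      by omega, by omega, hQ _ _ ?_ ?_ ?_ ?_⟩, fun h => ⟨by omega, by omega, hQ _ _ ?_ ?_ ?_ ?_⟩⟩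
  · constructor <;> try simp [State.setReg_reg, State.setReg_mem, env_setReg_iff, hE,
          State.setMem_mem, env_setMem_iff]
    · omega
    · intro i hi
      rw [if_neg (c := _ = 10 * (n + 2) + R k + 1) (by omega), tallyG_succ]
      by_cases hik : i = R k
      · rw [if_pos (c := i = R k) hik, if_pos (c := _ ∧ _) ⟨hik.symm, hfresh⟩, hik, hG]
        omega
      · rw [if_neg (c := i = R k) hik, if_neg (c := _ ∧ _) (fun h => hik h.1.symm), hmem,
          hI.cntG i hi, hk]
        omega
    · intro i hi
      rw [tallyT_succ]
      by_cases hik : i = R k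
      · rw [if_pos (c := i = R k) hik, if_pos (c := _ ∧ _) ⟨hik.symm, hfresh, h⟩, hik, hT]
        omega
      · rw [if_neg (c := i = R k) hik, if_neg (c := _ = 9 * (n + 2) + R k) (by omega),
          if_neg (c := _ ∧ _) (fun h => hik h.1.symm), hmem, hI.cntT i hi, hk]
        omega
    · intro x hx
      rw [if_neg (by omega), if_neg (by omega), hmem, hI.frame x hx]
    · omega
  · simp [State.setReg_reg, State.setMem_reg, hE.r1]
  · simp [State.setReg_reg, State.setMem_reg, h11]
  · omega
  · constructor <;> try simp [State.setReg_reg, State.setReg_mem, env_setReg_iff, hE,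
          State.setMem_mem, env_setMem_iff]
    · omega
    · intro i hi
      rw [tallyG_succ]
      by_cases hik : i = R k
      · rw [if_pos (c := i = R k) hik, if_pos (c := _ ∧ _) ⟨hik.symm, hfresh⟩, hik, hG]
        omega
      · rw [if_neg (c := i = R k) hik, if_neg (c := _ ∧ _) (fun h => hik h.1.symm), hmem,
          hI.cntG i hi, hk]
        omega
    · intro i hi
      rw [tallyT_succ, if_neg (c := _ = 9 * (n + 2) + R k) (by omega), if_neg (c := _ ∧ _), hmem,
        hI.cntT i hi, hk]
      · omega
      · rintro ⟨h1, _, h2⟩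
        exact absurd h2 (by rw [not_lt]; exact h)
    · intro x hx
      rw [if_neg (by omega), hmem, hI.frame x hx]
    · omega
  · simp [State.setReg_reg, State.setMem_reg, hE.r1]
  · simp [State.setReg_reg, State.setMem_reg, h11]
  · omega

theorem vc_count {α : Type u} {B b n : ℕ} {w : List α} {s : State} {R S S' : ℕ → ℕ}
    {Q : State → ℕ → Prop} (hE : Env n s) (hB : 12 * (n + 2) ≤ B) (hRn : ∀ m, R m ≤ n)
    (hR : ∀ m ≤ 2 * n, s.mem (n + 2 + m) = R m)
    (hS : ∀ e ≤ n + 1, s.mem (7 * (n + 2) + e) = S e)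
    (hS' : ∀ e ≤ n + 1, s.mem (8 * (n + 2) + e) = S' e)
    (hG : ∀ i ≤ n, s.mem (9 * (n + 2) + i) = if S (i + 1) = 0 then 0 else 1)
    (hT : ∀ i ≤ n, s.mem (10 * (n + 2) + i + 1) = if S (i + 1) = 0 then 0 else 2)
    (hb : 400 * (n + 1) ≤ b)
    (hQ : ∀ s' b', Env n s' →
      (∀ i ≤ n, s'.mem (9 * (n + 2) + i) =
        (if S (i + 1) = 0 then 0 else 1) + tallyG R S' n (2 * n + 1) i) →
      (∀ i ≤ n, s'.mem (10 * (n + 2) + i + 1) =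
        (if S (i + 1) = 0 then 0 else 2) + tallyT R S S' n (2 * n + 1) i) →
      (∀ x < 9 * (n + 2), s'.mem x = s.mem x) →
      b ≤ b' + 400 * (n + 1) → Q s' b') :
    vc B w countProg Q s b := by
  refine ⟨by omega, by omega, CountInv R S S' n s b, ?_, ?_⟩
  · constructor <;> try simp [State.setReg_reg, State.setReg_mem, env_setReg_iff, hE]
    · intro i hi
      simpa [tallyG] using hG i hi
    · intro i hi
      simpa [tallyT] using hT i hi
    · omega
  · intro s' b' hI
    have hE' := hI.env
    have hle := hI.le
    have hbud := hI.budget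
    refine ⟨trivial, by omega, fun hc => ?_, fun hc => ?_⟩
    · simp only [Test.Holds, hE'.r9] at hc
      obtain ⟨k, hk⟩ : ∃ k, s'.reg 11 = k := ⟨_, rfl⟩
      have hld : s'.mem (n + 2 + k) = R k := by
        rw [hI.frame _ (by omega), hR _ (by omega)]
      have hld' : s'.mem (n + 1 - (k - R k) + 8 * (n + 2)) = S' (n + 1 - (k - R k)) := by
        rw [hI.frame _ (by omega), ← hS' _ (by omega), add_comm]
      have hRk := hRn k
      have hS₁ : ∀ e ≤ n + 1, s'.mem (7 * (n + 2) + e) = S e := fun e he => by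
        rw [hI.frame _ (by omega), hS e he]
      have hstep : ∀ (s₁ : State) b₁, CountInv R S S' n s b (s₁.setReg 11 (k + 1)) (b₁ - 5) →
          s₁.reg 1 = 1 → s₁.reg 11 = k → 5 ≤ b₁ →
          s₁.reg 11 + s₁.reg 1 < B ∧ 1 ≤ b₁ ∧ 1 ≤ b₁ - 1 ∧
          CountInv R S S' n s b (s₁.setReg 11 (s₁.reg 11 + s₁.reg 1)) (b₁ - 1 - 1) := by
        intro s₁ b₁ h1 h2 h3 h4
        rw [h2, h3]
        exact ⟨by omega, by omega, by omega, { h1 with budget := by have := h1.budget; omega }⟩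
      simp [block, vc, Test.Defined, Test.Holds, State.setReg_reg, State.setReg_mem, hE'.r1,
        hE'.r2, hE'.r6, hE'.r10, hk, hld, hld']
      refine ⟨by omega, by omega, by omega, by omega, by omega, by omega, by omega, by omega,
        by omega, by omega, by omega, by omega, by omega, by omega, by omega, by omega,
        fun h => ?_, fun h => ⟨by omega, fun h' => ?_, fun h' => ?_⟩⟩
      · refine vc_tally hI hB hb ?_ (hRn k) hS₁ hk (by omega) ?_ ?_ ?_ ?_ (Or.inl h)
          (by omega) hstep <;> simp [State.setReg_reg, State.setReg_mem, env_setReg_iff, hE', hk]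
      · refine vc_tally hI hB hb ?_ (hRn k) hS₁ hk (by omega) ?_ ?_ ?_ ?_ (Or.inr h')
          (by omega) hstep <;> simp [State.setReg_reg, State.setReg_mem, env_setReg_iff, hE', hk]
      · have hnf : ¬ IsFresh R S' n k := by
          unfold IsFresh
          omega
        refine ⟨by omega, by omega, by omega, by omega, ?_⟩
        constructor <;> try simp [State.setReg_reg, State.setReg_mem, env_setReg_iff, hE']
        · omega
        · intro i hi
          rw [hI.cntG i hi, hk, tallyG_succ, if_neg (c := _ ∧ _) (fun h => hnf h.2), add_zero]
        · intro i hi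
          rw [hI.cntT i hi, hk, tallyT_succ, if_neg (c := _ ∧ _) (fun h => hnf h.2.1), add_zero]
        · exact hI.frame
        · omega
    · simp only [Test.Holds, hE'.r9] at hc
      have hk : s'.reg 11 = 2 * n + 1 := by omega
      exact ⟨by omega, hQ _ _ hE' (hk ▸ hI.cntG) (hk ▸ hI.cntT) hI.frame (by omega)⟩

/-- Copy the array in the cells after the one in register `r` to the cells from `0` on. -/
def copyProg (r : ℕ) : Prog :=
  block [.copy 20 r, .const 11 1, .const 14 0, .loop (.lt 11 10) (block [.add 13 20 11,
    .load 13 13, .store 14 13, .copy 14 11, .add 11 11 1])]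

/-- Only cells below `n` are written and only cells above `a ≥ n` are read, so the source is never
overwritten. -/
theorem vc_copy {α : Type u} {B b n r a : ℕ} {w : List α} {s : State}
    {Q : State → ℕ → Prop} (hE : Env n s) (hB : 12 * (n + 2) ≤ B)
    (hr : s.reg r = a) (ha : n ≤ a) (ha' : a ≤ 10 * (n + 2)) (hb : 400 * (n + 1) ≤ b)
    (hQ : ∀ s' b', (∀ i < n, s'.mem i = s.mem (a + (i + 1))) → Q s' b') :
    vc B w (copyProg r) Q s b := by
  refine ⟨by omega, by omega, by omega, by omega, by omega,
    fun s' b' => Env n s' ∧ s'.reg 20 = a ∧ 1 ≤ s'.reg 11 ∧ s'.reg 11 ≤ n + 1 ∧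
    s'.reg 14 = s'.reg 11 - 1 ∧ (∀ i < s'.reg 11 - 1, s'.mem i = s.mem (a + (i + 1))) ∧
    (∀ x, n ≤ x → s'.mem x = s.mem x) ∧ b ≤ b' + 3 + 20 * s'.reg 11, ?_, ?_⟩
  · simp [State.setReg_reg, State.setReg_mem, env_setReg_iff, hE, hr]
    omega
  · rintro s' b' ⟨hE', h20, hpos, hle, h14, hout, hfr, hbud⟩
    refine ⟨trivial, by omega, fun hc => ?_, fun hc => ?_⟩
    · simp only [Test.Holds, hE'.r10] at hc
      have hld : s'.mem (a + s'.reg 11) = s.mem (a + s'.reg 11) := hfr _ (by omega)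
      simp [block, vc, State.setReg_reg, State.setReg_mem, State.setMem_reg, hE'.r1,
        env_setReg_iff, env_setMem_iff, hE', hld, State.setMem_mem, h20, h14]
      refine ⟨by omega, by omega, by omega, by omega, by omega, by omega, by omega, by omega,
        by omega, fun i hi => ?_, fun x hx => ?_, by omega⟩
      · split_ifs with h
        · congr 1
          omega
        · exact hout i (by omega)
      · rw [if_neg (by omega), hfr x hx]
    · simp only [Test.Holds, hE'.r10] at hc
      exact ⟨by omega, hQ _ _ (fun m hm => hout m (by omega))⟩

/-! ## Suffix-palindromes as intervals -/

section Words

variable {α : Type u} {w : List α} {e l : ℕ}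

theorem palindrome_iff_getElem? {v : List α} :
    v.Palindrome ↔ ∀ k < v.length, v[k]? = v[v.length - 1 - k]? := by
  rw [List.Palindrome.iff_reverse_eq]
  constructor
  · intro h k hk
    conv_lhs => rw [← h, List.getElem?_reverse hk]
  · intro h
    apply List.ext_getElem?
    intro k
    by_cases hk : k < v.length
    · rw [List.getElem?_reverse hk, h k hk]
    · rw [List.getElem?_eq_none (by simpa using hk), List.getElem?_eq_none (by simpa using hk)]

theorem suffixPal_take (he : e ≤ w.length) :
    SuffixPal (w.take e) l ↔ l ≤ e ∧ IsPal (fun k => w[k]?) (e - l) e := by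
  unfold SuffixPal
  rw [List.length_take, min_eq_left he, palindrome_iff_getElem?]
  refine and_congr_right fun hl => ?_
  rw [List.length_drop, List.length_take, min_eq_left he]
  have hget : ∀ k, k < l → ((w.take e).drop (e - l))[k]? = w[e - l + k]? := by
    intro k hk
    rw [List.getElem?_drop, List.getElem?_take_of_lt (by omega)]
  constructor
  · intro h k hk hke
    have := h (k - (e - l)) (by omega)
    rw [hget _ (by omega), hget _ (by omega)] at this
    convert this using 2 <;> omega
  · intro h k hk
    rw [hget _ (by omega), hget _ (by omega)]
    have := h (e - l + k) (by omega) (by omega)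
    dsimp only at this
    rw [this]
    congr 1
    omega

theorem leftChar_take_of_lt (he : e ≤ w.length) (hl : l < e) :
    leftChar (w.take e) l = w[e - l - 1]? := by
  unfold leftChar
  rw [List.length_take, min_eq_left he, List.take_take, min_eq_left (by omega),
    List.getLast?_eq_getElem?, List.length_take, min_eq_left (by omega),
    List.getElem?_take_of_lt (by omega)]

theorem leftChar_take_self (he : e ≤ w.length) : leftChar (w.take e) e = none := by
  unfold leftChar
  rw [List.length_take, min_eq_left he]
  simp

/-- The lengths of the representatives of the suffix-pal-groups of `v`. -/
def reps (v : List α) : Set ℕ :=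
  {l | SuffixPal v l ∧ ∀ l' < l, SuffixPal v l' → leftChar v l' ≠ leftChar v l}

theorem repLength_palGroup {v : List α} (h : l ∈ reps v) :
    repLength (palGroup v (leftChar v l)) = l := by
  have hmem : l ∈ palGroup v (leftChar v l) := ⟨h.1, rfl⟩
  refine le_antisymm (Nat.sInf_le hmem) ?_
  by_contra! hlt
  have := Nat.sInf_mem (s := palGroup v (leftChar v l)) ⟨l, hmem⟩
  exact h.2 _ hlt this.1 this.2

/-- A group is determined by the left character of any of its members, hence by its shortest member.
Counting and ranking groups thus reduce to counting lengths in `reps v`. -/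
theorem bijOn_repLength (v : List α) : Set.BijOn repLength (palGroups v) (reps v) := by
  refine ⟨?_, ?_, ?_⟩
  · rintro _ ⟨c, rfl, hne⟩
    have h := Nat.sInf_mem hne
    refine ⟨h.1, fun l' hl' hp hc => ?_⟩
    exact Nat.notMem_of_lt_sInf hl' ⟨hp, hc.trans h.2⟩
  · rintro _ ⟨c, rfl, hne⟩ _ ⟨c', rfl, hne'⟩ heq
    have h := Nat.sInf_mem hne
    have h' := Nat.sInf_mem hne'
    have heq' : sInf (palGroup v c) = sInf (palGroup v c') := heq
    rw [← heq'] at h'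
    rw [← h.2, ← h'.2]
  · intro l hl
    exact ⟨_, ⟨_, rfl, l, hl.1, rfl⟩, repLength_palGroup hl⟩

theorem ncard_palGroups (v : List α) : (palGroups v).ncard = (reps v).ncard :=
  (bijOn_repLength v).ncard_eq

theorem groupId_eq (v : List α) (g : Set ℕ) :
    groupId v g = {l | l ∈ reps v ∧ l ≤ repLength g}.ncard := by
  have h : {l | l ∈ reps v ∧ l ≤ repLength g} =
      repLength '' {h | h ∈ palGroups v ∧ repLength h ≤ repLength g} := by
    rw [← (bijOn_repLength v).image_eq]
    ext l
    constructor
    · rintro ⟨⟨h, hh, rfl⟩, hl⟩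
      exact ⟨h, ⟨hh, hl⟩, rfl⟩
    · rintro ⟨h, ⟨hh, hl⟩, rfl⟩
      exact ⟨⟨h, hh, rfl⟩, hl⟩
  rw [h, ((bijOn_repLength v).injOn.mono fun _ hx => hx.1).ncard_image]
  rfl

end Words

/-! ### Codes of shortest palindromes, and reflection -/

section Codes

variable {β : Type*} {f : ℕ → β} {n : ℕ}

theorem isPal_iff_le_rad {e l : ℕ} (he : e ≤ n) (hl : l ≤ e) :
    IsPal f (e - l) e ↔ e ≤ rad f n (2 * e - l) := by
  rw [le_rad_iff (by omega) (by omega) (by omega) he]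
  congr! 1
  omega

theorem isPal_succ_iff {e l : ℕ} (hl : l < e) :
    IsPal f (e + 1 - (l + 2)) (e + 1) ↔ IsPal f (e - l) e ∧ f (e - l - 1) = f e := by
  obtain ⟨c, rfl⟩ : ∃ c, e = c + 1 := ⟨e - 1, by omega⟩
  rw [isPal_extend (by omega), show c + 1 + 1 - (l + 2) = c + 1 - l - 1 by omega,
    show c + 1 - l - 1 + 1 = c + 1 - l by omega]

/-- `topCode (rad f n) e` is the code of the length of the shortest suffix-palindrome of length at
least `2` of the prefix of length `e`. -/
theorem topCode_rad {e l : ℕ} (he : e ≤ n) :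
    topCode (rad f n) e = l + 3 ↔ l + 2 ≤ e ∧ IsPal f (e - (l + 2)) e ∧
      ∀ l' < l, ¬ IsPal f (e - (l' + 2)) e := by
  constructor
  · intro h
    rcases topCode_cases (rad f n) e with ⟨h0, _⟩ | ⟨m, h1, h2, h3, h4⟩
    · omega
    · have hm := (rad_spec (f := f) (n := n) (m := m) (by omega)).2.1
      obtain rfl : m = 2 * e - (l + 2) := by omega
      refine ⟨by omega, (isPal_iff_le_rad he (by omega)).2 h2, fun l' hl' hp => ?_⟩
      rw [isPal_iff_le_rad he (by omega)] at hp
      have := (h3 (2 * e - (l' + 2)) (by omega) (by omega)).trans_le hp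
      omega
  · rintro ⟨h1, h2, h3⟩
    rw [topCode_eq (m := 2 * e - (l + 2)) (by omega) ((isPal_iff_le_rad he h1).1 h2)]
    · omega
    · intro m' hm' hm2
      by_contra! h4
      have hm := (rad_spec (f := f) (n := n) (m := m') (by omega)).2.1
      obtain ⟨l', rfl⟩ : ∃ l', m' = 2 * e - (l' + 2) := ⟨2 * e - m' - 2, by omega⟩
      exact h3 l' (by omega) ((isPal_iff_le_rad he (by omega)).2 h4)

theorem topCode_rad_eq_zero {e : ℕ} (he : e ≤ n) :
    topCode (rad f n) e = 0 ↔ ∀ l, l + 2 ≤ e → ¬ IsPal f (e - (l + 2)) e := by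
  constructor
  · intro h l hl hp
    rcases topCode_cases (rad f n) e with ⟨_, h0⟩ | ⟨m, h1, h2, h3, h4⟩
    · rw [isPal_iff_le_rad he hl] at hp
      have := (h0 (2 * e - (l + 2)) (by omega)).trans_le hp
      omega
    · omega
  · intro h
    apply topCode_eq_zero
    intro m hm2
    by_contra! h4
    have hm := (rad_spec (f := f) (n := n) (m := m) (by omega)).2.1
    obtain ⟨l', rfl⟩ : ∃ l', m = 2 * e - (l' + 2) := ⟨2 * e - m - 2, by omega⟩
    exact h l' (by omega) ((isPal_iff_le_rad he (by omega)).2 h4)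

theorem topCode_rad_cases (f : ℕ → β) (n e : ℕ) :
    topCode (rad f n) e = 0 ∨ ∃ l, topCode (rad f n) e = l + 3 := by
  rcases topCode_cases (rad f n) e with ⟨h0, _⟩ | ⟨m, h1, h2, h3, h4⟩
  · exact Or.inl h0
  · exact Or.inr ⟨2 * e - m - 2, by omega⟩

theorem topCode_rad_succ : topCode (rad f n) (n + 1) = 0 :=
  topCode_eq_zero fun _ _ => Nat.lt_succ_of_le rad_le

theorem topCode_zero (A : ℕ → ℕ) : topCode A 0 = 0 :=
  topCode_eq_zero fun _ _ => by omega

/-- The right ends of the maximal palindromes of the reversed string. -/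
noncomputable def revRad (f : ℕ → β) (n m : ℕ) : ℕ := rad f n (2 * n - m) + m - n

theorem revRad_le {m : ℕ} (hm : m ≤ 2 * n) : revRad f n m ≤ n := by
  have := (rad_spec (f := f) (n := n) (m := 2 * n - m) (by omega)).2.1
  unfold revRad
  omega

theorem topCode_revRad_succ : topCode (revRad f n) (n + 1) = 0 :=
  topCode_eq_zero fun _ hm => Nat.lt_succ_of_le (revRad_le (by omega))

/-- Reversal carries `[p, k)` to `[n - k, n - p)`, whose doubled centre is `2 * n - (p + k)`;
starting at `p` becomes ending at `n - p`. -/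
theorem le_revRad_iff {p k : ℕ} (hp : p + 2 ≤ k) (hk : k ≤ n) :
    n - p ≤ revRad f n (2 * n - (p + k)) ↔ IsPal f p k := by
  have h1 := le_rad_iff (f := f) (n := n) (m := p + k) (e := k) (by omega) (by omega) (by omega) hk
  have h2 := (rad_spec (f := f) (n := n) (m := p + k) (by omega)).1
  rw [Nat.add_sub_cancel] at h1
  rw [← h1]
  unfold revRad
  rw [show 2 * n - (2 * n - (p + k)) = p + k by omega]
  omega

/-- The test `IsFresh`, in terms of palindromes. -/
theorem topCode_revRad_iff {p i : ℕ} (hp : p < n) (hi : i ≤ n) (hpi : p + 1 ≤ i) :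
    (topCode (revRad f n) (n - p) = 0 ∨ i - (p + 1) + 2 < topCode (revRad f n) (n - p)) ↔
      ∀ k, p + 2 ≤ k → k ≤ i → ¬ IsPal f p k := by
  -- A centre of the reversed string that covers the end `n - p` comes from a palindrome starting at
  -- `p`.
  have key : ∀ m, m + 2 ≤ 2 * (n - p) → n - p ≤ revRad f n m →
      2 * n - m - p ≤ n ∧ IsPal f p (2 * n - m - p) := by
    intro m h1 h2
    have h3 := rad_le (f := f) (n := n) (m := 2 * n - m)
    have h4 := (rad_spec (f := f) (n := n) (m := 2 * n - m) (by omega)).1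
    have h5 : 2 * n - m - p ≤ n := by
      unfold revRad at h2
      omega
    refine ⟨h5, (le_revRad_iff (by omega) h5).1 ?_⟩
    rwa [show 2 * n - (p + (2 * n - m - p)) = m by omega]
  rcases topCode_cases (revRad f n) (n - p) with ⟨h0, hno⟩ | ⟨m, h1, h2, h3, h4⟩
  · refine iff_of_true (Or.inl h0) fun k hk1 hk2 hpal => ?_
    rw [← le_revRad_iff (n := n) hk1 (by omega)] at hpal
    exact absurd hpal (not_le.2 (hno (2 * n - (p + k)) (by omega)))
  · obtain ⟨h5, h6⟩ := key m h1 h2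
    rw [h4]
    constructor
    · intro h k hk1 hk2 hpal
      rw [← le_revRad_iff (n := n) hk1 (by omega)] at hpal
      exact absurd hpal (not_le.2 (h3 (2 * n - (p + k)) (by omega) (by omega)))
    · intro h
      right
      by_contra! hlt
      exact h _ (by omega) (by omega) h6

/-- The palindrome `[s, e)` has on its left a char that occurs to the left of a shorter
suffix-palindrome if and only if this char starts a short palindrome. -/
theorem fresh_iff {s e : ℕ} (hse : s ≤ e) (hp : IsPal f s e) (hs : 0 < s) :
    (∀ l < e - s, IsPal f (e - l) e → f (e - l - 1) ≠ f (s - 1)) ↔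
      ∀ k, s - 1 + 2 ≤ k → k ≤ e → ¬ IsPal f (s - 1) k := by
  -- Reflection in `[s, e)` turns the suffix-palindrome of length `l` into the prefix `[s, s + l)`,
  -- and the character to its left into the one at `s + l`. If that equals the character at `s - 1`,
  -- the prefix extends outwards to `[s - 1, s + l + 1)`.
  have key : ∀ l < e - s, (IsPal f (s - 1) (s + l + 1) ↔
      IsPal f (e - l) e ∧ f (e - l - 1) = f (s - 1)) := by
    intro l hl
    obtain ⟨t, rfl⟩ : ∃ t, s = t + 1 := ⟨s - 1, by omega⟩
    rw [Nat.add_sub_cancel, show t + 1 + l + 1 = t + l + 2 by omega, isPal_extend (by omega),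
      ← hp.reflect_iff (a := t + 1) (b := t + l + 1) (by omega) (by omega) (by omega),
      show t + 1 + e - (t + l + 1) = e - l by omega, show t + 1 + e - (t + 1) = e by omega,
      hp (e - l - 1) (by omega) (by omega), eq_comm (a := f t)]
    congr! 3
    omega
  constructor
  · intro h k hk1 hk2 hpal
    obtain ⟨l, rfl⟩ : ∃ l, k = s + l + 1 := ⟨k - s - 1, by omega⟩
    obtain ⟨h1, h2⟩ := (key l (by omega)).1 hpal
    exact h l (by omega) h1 h2
  · intro h l hl h1 h2
    exact h (s + l + 1) (by omega) (by omega) ((key l hl).2 ⟨h1, h2⟩)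

end Codes

/-! ## Counting the groups -/

section Count

variable {α : Type u} {w : List α} {e : ℕ}

theorem mem_reps_take_iff (he : e ≤ w.length) {l : ℕ} :
    l ∈ reps (w.take e) ↔ l ≤ e ∧ IsPal (fun k => w[k]?) (e - l) e ∧
      (l < e → ∀ l' < l, IsPal (fun k => w[k]?) (e - l') e → w[e - l' - 1]? ≠ w[e - l - 1]?) := by
  unfold reps
  rw [Set.mem_ofPred_eq, suffixPal_take he, and_assoc]
  refine and_congr_right fun hl => and_congr_right fun _ => ?_
  rcases Nat.eq_or_lt_of_le hl with rfl | hlt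
  · refine iff_of_true (fun l' hl' _ => ?_) (fun h => absurd h (lt_irrefl _))
    rw [leftChar_take_self he, leftChar_take_of_lt he hl']
    rw [List.getElem?_eq_getElem (by omega)]
    exact Option.some_ne_none _
  · rw [forall_prop_of_true hlt]
    refine forall₂_congr fun l' hl' => ?_
    rw [suffixPal_take he, leftChar_take_of_lt he (hl'.trans hlt), leftChar_take_of_lt he hlt,
      and_iff_right (by omega)]

/-- A suffix-palindrome of `w[0, e)` that is maximal in `w` is a representative if and only if
it passes the test `IsFresh`. -/
theorem mem_reps_iff_isFresh (he : e ≤ w.length) {m : ℕ} (hm : m ≤ 2 * w.length)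
    (hR : rad (fun k => w[k]?) w.length m = e) : 2 * e - m ∈ reps (w.take e) ↔
      IsFresh (rad (fun k => w[k]?) w.length) (topCode (revRad (fun k => w[k]?) w.length))
        w.length m := by
  obtain ⟨h1, h2, h3⟩ := rad_spec (f := fun k => w[k]?) hm
  rw [hR] at h1 h2 h3
  unfold IsFresh
  rw [mem_reps_take_iff he, hR, show e - (2 * e - m) = m - e by omega,
    and_iff_right (by omega), and_iff_right h3]
  -- When the palindrome is the whole prefix it has no left character and is alone in its group; the
  -- code at index `n + 1` is `0`, so the test agrees.
  rcases Nat.eq_zero_or_pos (m - e) with h0 | hpos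
  · rw [h0, Nat.sub_zero, topCode_revRad_succ]
    exact iff_of_true (fun h => absurd h (by omega)) (Or.inl rfl)
  · rw [forall_prop_of_true (by omega)]
    have hf := fresh_iff (f := fun k => w[k]?) (s := m - e) (e := e) (by omega) h3 hpos
    rw [show e - (m - e) = 2 * e - m by omega] at hf ⊢
    rw [hf, ← topCode_revRad_iff (by omega) he (by omega)]
    rw [show w.length - (m - e - 1) = w.length + 1 - (m - e) by omega,
      show e - (m - e - 1 + 1) = 2 * e - m by omega]

/-- The representatives are the maximal suffix-palindromes that pass the test `IsFresh`, and the
shortest one that is extended by the next char. -/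
theorem mem_reps_iff (he : e ≤ w.length) {l : ℕ} : l ∈ reps (w.take e) ↔
    (∃ m ≤ 2 * w.length, rad (fun k => w[k]?) w.length m = e ∧
      IsFresh (rad (fun k => w[k]?) w.length) (topCode (revRad (fun k => w[k]?) w.length))
        w.length m ∧ 2 * e - m = l) ∨
    topCode (rad (fun k => w[k]?) w.length) (e + 1) = l + 3 := by
  constructor
  · intro h
    have h' := h
    rw [mem_reps_take_iff he] at h'
    obtain ⟨hl, hp, hmin⟩ := h'
    have hr := (isPal_iff_le_rad (f := fun k => w[k]?) he hl).1 hp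
    have hrn := rad_le (f := fun k => w[k]?) (n := w.length) (m := 2 * e - l)
    obtain ⟨h1, h2, h3⟩ := rad_spec (f := fun k => w[k]?) (n := w.length) (m := 2 * e - l)
      (by omega)
    -- Either the palindrome is maximal with right end `e`, or it extends by the next character.
    rcases Nat.eq_or_lt_of_le hr with heq | hlt
    · refine Or.inl ⟨2 * e - l, by omega, heq.symm, ?_, by omega⟩
      rw [← mem_reps_iff_isFresh he (by omega) heq.symm]
      rwa [show 2 * e - (2 * e - l) = l by omega]
    · right
      have hext := h3.shrink (e' := e + 1) h2 (by omega) (by omega)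
      have hlast := (isPal_succ_iff (f := fun k => w[k]?) (e := e) (l := l) (by omega)).1
        (by rwa [show e + 1 - (l + 2) = 2 * e - l - (e + 1) by omega])
      rw [topCode_rad (by omega)]
      refine ⟨by omega, ?_, fun l' hl' hp' => ?_⟩
      · rwa [show e + 1 - (l + 2) = 2 * e - l - (e + 1) by omega]
      · rw [isPal_succ_iff (by omega)] at hp'
        -- Any two suffix-palindromes extended by the next character share it as left character, so
        -- a representative among them is the shortest.
        exact hmin (by omega) l' hl' hp'.1 (hp'.2.trans hlast.2.symm)
  · rintro (⟨m, hm, hR, hf, rfl⟩ | h)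
    · exact (mem_reps_iff_isFresh he hm hR).2 hf
    · have hen : e + 1 ≤ w.length := by
        rcases Nat.eq_or_lt_of_le he with rfl | h'
        · rw [topCode_rad_succ] at h
          omega
        · exact h'
      rw [topCode_rad hen] at h
      obtain ⟨h1, h2, h3⟩ := h
      rw [isPal_succ_iff (by omega)] at h2
      rw [mem_reps_take_iff he]
      refine ⟨by omega, h2.1, fun _ l' hl' hp' heq => h3 l' hl' ?_⟩
      rw [isPal_succ_iff (by omega)]
      exact ⟨hp', heq.trans h2.2⟩

/-- The predicate `P` serves both counts: it is always true for the number of groups, and bounds the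
length for the rank of a group. -/
theorem ncard_reps (he : e ≤ w.length) (P : ℕ → Prop) [DecidablePred P] :
    {l | l ∈ reps (w.take e) ∧ P l}.ncard =
      ((Finset.range (2 * w.length + 1)).filter fun m =>
        rad (fun k => w[k]?) w.length m = e ∧
        IsFresh (rad (fun k => w[k]?) w.length) (topCode (revRad (fun k => w[k]?) w.length))
          w.length m ∧ P (2 * e - m)).card +
      if topCode (rad (fun k => w[k]?) w.length) (e + 1) = 0 then 0 else
        if P (topCode (rad (fun k => w[k]?) w.length) (e + 1) - 3) then 1 else 0 := by
  classical
  set R := rad (fun k => w[k]?) w.length with hR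
  set S' := topCode (revRad (fun k => w[k]?) w.length) with hS'
  set F := (Finset.range (2 * w.length + 1)).filter fun m =>
    R m = e ∧ IsFresh R S' w.length m ∧ P (2 * e - m) with hF
  have hspec : ∀ m ∈ F, m ≤ 2 * e := by
    intro m hm
    rw [hF, Finset.mem_filter, Finset.mem_range] at hm
    rw [← hm.2.1]
    exact (rad_spec (by omega)).1
  have hinj : Set.InjOn (fun m => 2 * e - m) (F : Set ℕ) := by
    intro m hm m' hm' heq
    have h1 := hspec m hm
    have h2 := hspec m' hm'
    dsimp only at heq
    omega
  have himage : ∀ l, l ∈ F.image (fun m => 2 * e - m) ↔ P l ∧ ∃ m ≤ 2 * w.length, R m = e ∧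
      IsFresh R S' w.length m ∧ 2 * e - m = l := by
    intro l
    simp only [hF, Finset.mem_image, Finset.mem_filter, Finset.mem_range, Nat.lt_succ_iff]
    constructor
    · rintro ⟨m, ⟨h1, h2, h3, h4⟩, rfl⟩
      exact ⟨h4, m, h1, h2, h3, rfl⟩
    · rintro ⟨h4, m, h1, h2, h3, rfl⟩
      exact ⟨m, ⟨h1, h2, h3, h4⟩, rfl⟩
  rw [← Finset.card_image_of_injOn hinj]
  rcases topCode_rad_cases (fun k => w[k]?) w.length (e + 1) with h0 | ⟨t, ht⟩
  · rw [h0, if_pos rfl, add_zero, ← Set.ncard_coe_finset]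
    congr 1
    ext l
    rw [Finset.mem_coe, himage, Set.mem_ofPred_eq, mem_reps_iff he, h0]
    constructor
    · rintro ⟨h | h, hP⟩
      · exact ⟨hP, h⟩
      · omega
    · exact fun h => ⟨Or.inl h.2, h.1⟩
  · rw [ht, if_neg (by omega), Nat.add_sub_cancel]
    -- The extended representative has a centre whose maximal palindrome ends after `e`, so it is
    -- not among the maximal ones with right end `e`.
    have hnot : t ∉ F.image (fun m => 2 * e - m) := by
      rw [himage]
      rintro ⟨_, m, h1, h2, _, h3⟩
      have hen : e + 1 ≤ w.length := by
        rcases Nat.eq_or_lt_of_le he with rfl | h'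
        · rw [topCode_rad_succ] at ht
          omega
        · exact h'
      have h4 : m ≤ 2 * R m := (rad_spec (f := fun k => w[k]?) h1).1
      have h5 := ((topCode_rad hen).1 ht).2.1
      rw [isPal_iff_le_rad hen ((topCode_rad hen).1 ht).1,
        show 2 * (e + 1) - (t + 2) = m by omega] at h5
      have h6 : e + 1 ≤ R m := h5
      omega
    have hset : {l | l ∈ reps (w.take e) ∧ P l} =
        ((F.image (fun m => 2 * e - m) ∪ if P t then {t} else ∅ : Finset ℕ) : Set ℕ) := by
      ext l
      rw [Finset.mem_coe, Finset.mem_union, himage, Set.mem_ofPred_eq, mem_reps_iff he, ht]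
      constructor
      · rintro ⟨h | h, hP⟩
        · exact Or.inl ⟨hP, h⟩
        · obtain rfl : t = l := by omega
          right
          rw [if_pos hP]
          exact Finset.mem_singleton_self _
      · rintro (⟨hP, h⟩ | h)
        · exact ⟨Or.inl h, hP⟩
        · split_ifs at h with hP
          · rw [Finset.mem_singleton] at h
            subst h
            exact ⟨Or.inr rfl, hP⟩
          · simp at h
    rw [hset, Set.ncard_coe_finset, Finset.card_union_of_disjoint]
    · split_ifs <;> simp
    · split_ifs
      · rwa [Finset.disjoint_singleton_right]
      · exact Finset.disjoint_empty_right _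

theorem numGroups_eq (i : Fin w.length) : numGroups w i =
    (if topCode (rad (fun k => w[k]?) w.length) (i + 1 + 1) = 0 then 0 else 1) +
      tallyG (rad (fun k => w[k]?) w.length) (topCode (revRad (fun k => w[k]?) w.length))
        w.length (2 * w.length + 1) (i + 1) := by
  have h := ncard_reps (w := w) (e := i + 1) i.2 (fun _ => True)
  simp only [and_true, if_true] at h
  unfold numGroups tallyG
  rw [ncard_palGroups]
  exact h.trans (add_comm _ _)

theorem code_ssp (i : Fin w.length) :
    code (ssp w i) = topCode (rad (fun k => w[k]?) w.length) (i + 1) := by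
  have hi : (i : ℕ) + 1 ≤ w.length := i.2
  unfold ssp
  rcases topCode_rad_cases (fun k => w[k]?) w.length (i + 1) with h0 | ⟨t, ht⟩
  · have hset : {x : ℕ∞ | ∃ l : ℕ, 2 ≤ l ∧ SuffixPal (w.take (i + 1)) l ∧ x = l} = ∅ := by
      rw [Set.eq_empty_iff_forall_notMem]
      rintro x ⟨l, h1, h2, _⟩
      rw [suffixPal_take hi] at h2
      obtain ⟨l, rfl⟩ : ∃ l', l = l' + 2 := ⟨l - 2, by omega⟩
      exact (topCode_rad_eq_zero hi).1 h0 l h2.1 h2.2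
    rw [hset, sInf_empty, h0]
    simp [code]
  · obtain ⟨h1, h2, h3⟩ := (topCode_rad hi).1 ht
    have hinf : sInf {x : ℕ∞ | ∃ l : ℕ, 2 ≤ l ∧ SuffixPal (w.take (i + 1)) l ∧ x = l} =
        ((t + 2 : ℕ) : ℕ∞) := by
      refine IsLeast.csInf_eq ⟨⟨t + 2, by omega, (suffixPal_take hi).2 ⟨h1, h2⟩, rfl⟩, ?_⟩
      rintro x ⟨l, k1, k2, rfl⟩
      rw [suffixPal_take hi] at k2
      rw [Nat.cast_le]
      by_contra! hlt
      obtain ⟨l, rfl⟩ : ∃ l', l = l' + 2 := ⟨l - 2, by omega⟩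
      exact h3 l (by omega) k2.2
    rw [hinf, ht]
    unfold code
    rw [if_neg (ENat.natCast_ne_top _), ENat.toNat_natCast]

theorem mem_palGroup_take_iff (i : Fin w.length) {l : ℕ} :
    l ∈ palGroup (w.take i) (some (w.get i)) ↔
      l + 2 ≤ i + 1 ∧ IsPal (fun k => w[k]?) (i + 1 - (l + 2)) (i + 1) := by
  have hi : (i : ℕ) ≤ w.length := i.2.le
  have hget : some (w.get i) = w[(i : ℕ)]? := (List.getElem?_eq_getElem i.2).symm
  unfold palGroup
  rw [Set.mem_ofPred_eq, suffixPal_take hi, hget, and_assoc]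
  constructor
  · rintro ⟨h1, h2, h3⟩
    rcases Nat.eq_or_lt_of_le h1 with rfl | hlt
    · rw [leftChar_take_self hi, ← hget] at h3
      exact absurd h3.symm (Option.some_ne_none _)
    · rw [leftChar_take_of_lt hi hlt] at h3
      exact ⟨by omega, (isPal_succ_iff hlt).2 ⟨h2, h3⟩⟩
  · rintro ⟨h1, h2⟩
    rw [isPal_succ_iff (by omega)] at h2
    rw [leftChar_take_of_lt hi (by omega)]
    exact ⟨by omega, h2⟩

/-- The rank of the extended group counts its own representative, of length `t`, and the maximal
representatives of length at most `t`; `code` adds one more. -/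
theorem code_sspg (i : Fin w.length) : code (sspg w i) =
    (if topCode (rad (fun k => w[k]?) w.length) (i + 1) = 0 then 0 else 2) +
      tallyT (rad (fun k => w[k]?) w.length) (topCode (rad (fun k => w[k]?) w.length))
        (topCode (revRad (fun k => w[k]?) w.length)) w.length (2 * w.length + 1) i := by
  have hi : (i : ℕ) + 1 ≤ w.length := i.2
  unfold sspg
  rcases topCode_rad_cases (fun k => w[k]?) w.length (i + 1) with h0 | ⟨t, ht⟩
  · rw [if_neg, if_pos h0]
    · unfold tallyT
      rw [Finset.card_eq_zero.2]
      · simp [code]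
      · rw [Finset.filter_eq_empty_iff]
        rintro m _ ⟨h1, _, h2⟩
        unfold IsBelow at h2
        rw [h1, h0] at h2
        omega
    · rintro ⟨l, hl⟩
      rw [mem_palGroup_take_iff] at hl
      exact (topCode_rad_eq_zero hi).1 h0 l hl.1 hl.2
  · obtain ⟨h1, h2, h3⟩ := (topCode_rad hi).1 ht
    have hmem : t ∈ palGroup (w.take i) (some (w.get i)) := (mem_palGroup_take_iff i).2 ⟨h1, h2⟩
    have hrep : repLength (palGroup (w.take i) (some (w.get i))) = t := by
      refine IsLeast.csInf_eq ⟨hmem, fun l hl => ?_⟩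
      by_contra! hlt
      exact h3 l hlt ((mem_palGroup_take_iff i).1 hl).2
    rw [if_pos ⟨t, hmem⟩, groupId_eq, hrep, ncard_reps i.2.le (fun l => l ≤ t), ht,
      Nat.add_sub_cancel, if_neg (c := t + 3 = 0) (by omega), if_pos (c := t ≤ t) le_rfl,
      if_neg (c := t + 3 = 0) (by omega)]
    unfold code tallyT
    rw [if_neg (ENat.natCast_ne_top _), ENat.toNat_natCast]
    have hfilter : ∀ m ∈ Finset.range (2 * w.length + 1),
        ((rad (fun k => w[k]?) w.length m = i ∧
          IsFresh (rad (fun k => w[k]?) w.length) (topCode (revRad (fun k => w[k]?) w.length))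
            w.length m ∧ 2 * (i : ℕ) - m ≤ t) ↔
        (rad (fun k => w[k]?) w.length m = i ∧
          IsFresh (rad (fun k => w[k]?) w.length) (topCode (revRad (fun k => w[k]?) w.length))
            w.length m ∧
          IsBelow (rad (fun k => w[k]?) w.length) (topCode (rad (fun k => w[k]?) w.length))
            m)) := by
      intro m hm
      rw [Finset.mem_range] at hm
      obtain ⟨k1, k2, _⟩ := rad_spec (f := fun k => w[k]?) (n := w.length) (m := m) (by omega)
      refine and_congr_right fun hR => and_congr_right fun _ => ?_
      unfold IsBelow
      rw [hR] at k1 k2 ⊢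
      rw [ht]
      -- Length `t` belongs to a centre that extends past `i`, whereas this one has right end `i`.
      -- So the bound `≤ t` agrees with the strict comparison in `IsBelow`.
      have hne : 2 * (i : ℕ) - m ≠ t := by
        intro heq
        rw [isPal_iff_le_rad hi h1, show 2 * ((i : ℕ) + 1) - (t + 2) = m by omega] at h2
        omega
      omega
    rw [Finset.filter_congr hfilter]
    omega

end Count

/-! ## The programs -/

/-- Compute the three arrays. -/
def arraysProg : Prog :=
  block [setupProg, manacherProg, reverseProg, .copy 20 2, .copy 21 5, coverProg, .copy 20 3,
    .copy 21 6, coverProg, initProg, countProg]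

theorem vc_arrays {α : Type u} {B b : ℕ} {w : List α} {Q : State → ℕ → Prop}
    (hB : 12 * (w.length + 2) ≤ B) (hb : 3000 * (w.length + 1) ≤ b)
    (hQ : ∀ s b', Env w.length s →
      (∀ e ≤ w.length, s.mem (7 * (w.length + 2) + e) =
        topCode (rad (fun k => w[k]?) w.length) e) →
      (∀ i ≤ w.length, s.mem (9 * (w.length + 2) + i) =
        (if topCode (rad (fun k => w[k]?) w.length) (i + 1) = 0 then 0 else 1) +
          tallyG (rad (fun k => w[k]?) w.length) (topCode (revRad (fun k => w[k]?) w.length))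
            w.length (2 * w.length + 1) i) →
      (∀ i ≤ w.length, s.mem (10 * (w.length + 2) + i + 1) =
        (if topCode (rad (fun k => w[k]?) w.length) (i + 1) = 0 then 0 else 2) +
          tallyT (rad (fun k => w[k]?) w.length) (topCode (rad (fun k => w[k]?) w.length))
            (topCode (revRad (fun k => w[k]?) w.length)) w.length (2 * w.length + 1) i) →
      500 * (w.length + 1) ≤ b' → Q s b') :
    vc B w arraysProg Q (State.init w.length) b := by
  simp only [arraysProg, block, vc]
  refine vc_setup hB (by omega) fun s₁ b₁ hE₁ hm₁ hb₁ => ?_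
  refine vc_manacher hE₁ hB (by omega) fun s₂ b₂ hE₂ hR₂ hf₂ hb₂ => ?_
  refine vc_reverse hE₂ hB hR₂ (fun _ => rad_le) (by omega) fun s₃ b₃ hE₃ hR₃ hf₃ hb₃ => ?_
  refine ⟨by omega, by omega, ?_⟩
  refine vc_cover (A := rad (fun k => w[k]?) w.length) (a := w.length + 2)
    (o := 7 * (w.length + 2)) ?_ hB ?_ ?_ (by omega) (by omega) (by omega) ?_ (by omega)
    fun s₄ b₄ hE₄ hS₄ hf₄ hb₄ => ⟨by omega, by omega, ?_⟩
  · simpa [env_setReg_iff]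
  · simp [State.setReg_reg, hE₃.r2]
  · simp [State.setReg_reg, hE₃.r5]
  · intro m hm
    simp only [State.setReg_mem]
    rw [hf₃ _ (by omega), hR₂ m hm]
  simp only [State.setReg_mem] at hf₄
  refine vc_cover (A := revRad (fun k => w[k]?) w.length) (a := 3 * (w.length + 2))
    (o := 8 * (w.length + 2)) ?_ hB ?_ ?_ (by omega) (by omega) (by omega) ?_ (by omega)
    fun s₅ b₅ hE₅ hS₅ hf₅ hb₅ => ?_
  · simpa [env_setReg_iff]
  · simp [State.setReg_reg, hE₄.r3]
  · simp [State.setReg_reg, hE₄.r6]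
  · intro m hm
    simp only [State.setReg_mem]
    rw [hf₄ _ (by omega) (by omega), hR₃ m hm]
    rfl
  simp only [State.setReg_mem] at hf₅
  -- The cover sweeps write positions `1` to `n` only. The sentinel entries at `0` and `n + 1` and
  -- the initial counters rely on memory that is still zero.
  have hzero : ∀ x, 7 * (w.length + 2) ≤ x → s₃.mem x = 0 := by
    intro x hx
    rw [hf₃ _ (by omega), hf₂ _ (by omega), hm₁]
  have hS : ∀ e ≤ w.length + 1, s₅.mem (7 * (w.length + 2) + e) =
      topCode (rad (fun k => w[k]?) w.length) e := by
    intro e he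
    rw [hf₅ _ (by omega) (by omega)]
    by_cases h : 1 ≤ e ∧ e ≤ w.length
    · exact hS₄ e h.1 h.2
    · rw [hf₄ _ (by omega) (by omega), hzero _ (by omega)]
      rcases (show e = 0 ∨ e = w.length + 1 by omega) with rfl | rfl
      · rw [topCode_zero]
      · rw [topCode_rad_succ]
  have hS' : ∀ e ≤ w.length + 1, s₅.mem (8 * (w.length + 2) + e) =
      topCode (revRad (fun k => w[k]?) w.length) e := by
    intro e he
    by_cases h : 1 ≤ e ∧ e ≤ w.length
    · exact hS₅ e h.1 h.2
    · rw [hf₅ _ (by omega) (by omega), hf₄ _ (by omega) (by omega), hzero _ (by omega)]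
      rcases (show e = 0 ∨ e = w.length + 1 by omega) with rfl | rfl
      · rw [topCode_zero]
      · rw [topCode_revRad_succ]
  refine vc_init hE₅ hB hS topCode_rad_succ ?_ (by omega)
    fun s₆ b₆ hE₆ hG₆ hT₆ hf₆ hb₆ => ?_
  · intro x hx
    rw [hf₅ _ (by omega) (by omega), hf₄ _ (by omega) (by omega), hzero _ (by omega)]
  refine vc_count (R := rad (fun k => w[k]?) w.length) hE₆ hB (fun _ => rad_le) ?_ ?_ ?_ hG₆ hT₆
    (by omega) fun s₇ b₇ hE₇ hG₇ hT₇ hf₇ hb₇ => ⟨by omega, hQ _ _ hE₇ ?_ hG₇ hT₇ (by omega)⟩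
  · intro m hm
    rw [hf₆ _ (by omega), hf₅ _ (by omega) (by omega), hf₄ _ (by omega) (by omega),
      hf₃ _ (by omega), hR₂ m hm]
  · intro e he
    rw [hf₆ _ (by omega), hS e he]
  · intro e he
    rw [hf₆ _ (by omega), hS' e he]
  · intro e he
    rw [hf₇ _ (by omega), hf₆ _ (by omega), hS e (by omega)]

theorem linearTime_of_vc {f : (α : Type u) → (w : List α) → Fin w.length → ℕ} (p : Prog)
    (h : ∀ (α : Type u) (w : List α), vc (3000 * (w.length + 1)) w p
      (fun s _ => ∀ i : Fin w.length, s.mem i = f α w i) (State.init w.length)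
      (3000 * (w.length + 1))) : LinearTime f :=
  ⟨p, 3000, fun α w => by
    obtain ⟨t, s, h1, h2, h3⟩ := exec_of_vc p _ _ _ (h α w)
    exact ⟨t, s, h1, h2, h3⟩⟩

end PalEnc

theorem mainTheorem8 :
    PalEnc.LinearTime.{u} (fun _ w i => PalEnc.code (PalEnc.ssp w i)) ∧
    PalEnc.LinearTime.{u} (fun _ w i => PalEnc.numGroups w i) ∧
    PalEnc.LinearTime.{u} (fun _ w i => PalEnc.code (PalEnc.sspg w i)) := by
  refine ⟨PalEnc.linearTime_of_vc (.seq PalEnc.arraysProg (PalEnc.copyProg 5)) fun α w => ?_,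
    PalEnc.linearTime_of_vc (.seq PalEnc.arraysProg (PalEnc.copyProg 7)) fun α w => ?_,
    PalEnc.linearTime_of_vc (.seq PalEnc.arraysProg (PalEnc.copyProg 8)) fun α w => ?_⟩
  · refine PalEnc.vc_arrays (by omega) le_rfl fun s b hE hS hG hT hb => ?_
    refine PalEnc.vc_copy hE (by omega) hE.r5 (by omega) (by omega) (by omega) fun s' _ h i => ?_
    rw [h i i.2, hS _ i.2, PalEnc.code_ssp]
  · refine PalEnc.vc_arrays (by omega) le_rfl fun s b hE hS hG hT hb => ?_
    refine PalEnc.vc_copy hE (by omega) hE.r7 (by omega) (by omega) (by omega) fun s' _ h i => ?_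
    rw [h i i.2, hG _ i.2, PalEnc.numGroups_eq]
  · refine PalEnc.vc_arrays (by omega) le_rfl fun s b hE hS hG hT hb => ?_
    refine PalEnc.vc_copy hE (by omega) hE.r8 (by omega) (by omega) (by omega) fun s' _ h i => ?_
    -- The second counters are stored one cell later than the first, so the same copying loop
    -- delivers the value for the prefix before the position instead of the one ending at it.
    rw [h i i.2, ← add_assoc, hT _ i.2.le, PalEnc.code_sspg]
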